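/- For a real skew symmetric $d\times d$ matrix $\Theta$ put $\omega_\Theta(x,y)=\exp(\pi i\langle \Theta x,y\rangle)$ for $x,y\in\mathbb Z^d$. The noncommutative $d$-torus $\mathcal A_\Theta=C^*(\mathbb Z^d,\omega_\Theta)$ is the full twisted group $C^*$-algebra, generated by the universal $\omega_\Theta$-representation $l_\Theta$ of $\mathbb Z^d$, that is, by unitaries $l_\Theta(x)$, $x\in\mathbb Z^d$, with $l_\Theta(x)l_\Theta(y)=\omega_\Theta(x,y)\,l_\Theta(x+y)$. Let $G_\Theta=\{A\in \mathrm{GL}_d(\mathbb Z): A^t\Theta A=\Theta\}$. For a subgroup $G$ of $\mathrm{GL}_d(\mathbb Z)$ we say that $\mathcal A_\Theta$ admits the canonical action of $G$ (or that $G$ acts canonically on $\mathcal A_\Theta$) if $G\subseteq G_\Theta$ and there is an action $\alpha:G\to \mathrm{Aut}(\mathcal A_\Theta)$ by $*$-automorphisms with $\alpha_A(l_\Theta(x))=l_\Theta(Ax)$ for all $A\in G$, $x\in\mathbb Z^d$. The companion matrix of a monic polynomial $a_0+a_1x+\dots+a_{d-1}x^{d-1}+x^d$ is the $d\times d$ matrix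 with ones directly below the diagonal, last column $(-a_0,\dots,-a_{d-1})^t$ and all other entries $0$. For $p$ prime, $C_p\in \mathrm{GL}_{p-1}(\mathbb Z)$ is the companion matrix of the cyclotomic polynomial $\Phi_p$, and $\mathbb Z_p=\langle C_p\rangle$. (a) Let $d\ge 3$, let $\Theta$ be a nonzero real skew symmetric $d\times d$ matrix, and let $C\in \mathrm{GL}_d(\mathbb Z)$ be the companion matrix of a monic integer polynomial of degree $d$. If $C$ has finite order $n$ and $\mathcal A_\Theta$ admits the canonical action of $\mathbb Z_n=\langle C\rangle$, then $\Theta$ is a Toeplitz matrix: there are real numbers $\theta_0,\dots,\theta_{d-2}$ such that $\Theta$ is the skew symmetric matrix with entries $\Theta_{ij}=\theta_{j-i-1}$ for $1\le i<j\le d$. (b) Let $p\ge 3$ be a prime number, $d=p-1$, and let $\Theta$ be a real skew symmetric $d\times d$ matrix. Then $\mathbb Z_p=\langle C_p\rangle$ acts canonically on $\mathcal A_\Theta$ if and only if there are real numbers $\theta_0,\theta_1,\dots,\theta_{(p-3)/2}$ such that $\Theta$ is the skew symmetric Toeplitz matrix with first row $$(0,\ \theta_0,\ \theta_1,\ \dots,\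 \theta_{(p-3)/2},\ -\theta_{(p-3)/2},\ \dots,\ -\theta_2,\ -\theta_1),$$ that is, for $1\le i<j\le d$, $\Theta_{ij}=\theta_{j-i-1}$ if $j-i\le (p-1)/2$ and $\Theta_{ij}=-\theta_{p-1-(j-i)}$ if $j-i>(p-1)/2$. (c) If $\Theta$ has the form in (b) and the real numbers $1,\theta_0,\theta_1,\dots,\theta_{(p-3)/2}$ are linearly independent over $\mathbb Z$, then $\mathcal A_\Theta$ is simple, i.e. it is nonzero and has no closed two-sided ideals other than $0$ and $\mathcal A_\Theta$. -/

import Mathlib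

open scoped ENNReal Matrix

noncomputable section

namespace NCTorus

/-! ### The cocycle of a real matrix and its twisted representations -/

/-- `ω_Θ(x, y) = exp(π i ⟨Θ x, y⟩)` for `x, y ∈ ℤ^d`. -/
def omega {d : ℕ} (Θ : Matrix (Fin d) (Fin d) ℝ) (x y : Fin d → ℤ) : Circle :=
  Circle.exp (Real.pi * ((Θ *ᵥ fun i => (x i : ℝ)) ⬝ᵥ fun i => (y i : ℝ)))

/-- An `ω_Θ`-representation of `ℤ^d` on a (nonzero, complex) Hilbert space `H`: a map `v` from `ℤ^d`
to the unitary group of `H` such that `v(x) v(y) = ω_Θ(x, y) v(x + y)`. -/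
structure TwistedRep {d : ℕ} (Θ : Matrix (Fin d) (Fin d) ℝ) : Type 1 where
  /-- the Hilbert space -/
  H : Type
  [normedAddCommGroup : NormedAddCommGroup H]
  [innerProductSpace : InnerProductSpace ℂ H]
  [completeSpace : CompleteSpace H]
  [nontrivial : Nontrivial H]
  /-- the unitaries -/
  v : (Fin d → ℤ) → unitary (H →L[ℂ] H)
  map_mul : ∀ x y, (v x : H →L[ℂ] H) * v y = (omega Θ x y : ℂ) • (v (x + y) : H →L[ℂ] H)

attribute [instance] TwistedRep.normedAddCommGroup TwistedRep.innerProductSpace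
  TwistedRep.completeSpace TwistedRep.nontrivial

/-- The `C*`-algebra of bounded families `(T_v)`, with `T_v` a bounded operator on the Hilbert space
of `v`, where `v` runs over all `ω_Θ`-representations; the norm is `sup_v ‖T_v‖`. -/
abbrev BoundedFamilies {d : ℕ} (Θ : Matrix (Fin d) (Fin d) ℝ) : Type 1 :=
  lp (fun ρ : TwistedRep Θ => (ρ.H →L[ℂ] ρ.H)) ∞

/-- The universal `ω_Θ`-representation `x ↦ (v(x))_v`. -/
def universalRep {d : ℕ} (Θ : Matrix (Fin d) (Fin d) ℝ) (x : Fin d → ℤ) : BoundedFamilies Θ :=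
  ⟨fun ρ => (ρ.v x : ρ.H →L[ℂ] ρ.H), memℓp_infty ⟨1, by
    rintro _ ⟨ρ, rfl⟩
    exact (CStarRing.norm_coe_unitary (ρ.v x)).le⟩⟩

/-- The noncommutative torus `A_Θ = C*(ℤ^d, ω_Θ)`, the full twisted group `C*`-algebra: the
`C*`-algebra generated by the universal `ω_Θ`-representation. Equivalently, the completion of the
twisted group algebra in the largest `C*`-norm, the supremum over all `ω_Θ`-representations. -/
abbrev Torus {d : ℕ} (Θ : Matrix (Fin d) (Fin d) ℝ) : StarSubalgebra ℂ (BoundedFamilies Θ) :=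
  (StarAlgebra.adjoin ℂ (Set.range (universalRep Θ))).topologicalClosure

/-- The canonical unitaries `l_Θ(x) ∈ A_Θ`, `x ∈ ℤ^d`. -/
def gen {d : ℕ} (Θ : Matrix (Fin d) (Fin d) ℝ) (x : Fin d → ℤ) : Torus Θ :=
  ⟨universalRep Θ x, StarSubalgebra.le_topologicalClosure _
    (StarAlgebra.subset_adjoin ℂ _ ⟨x, rfl⟩)⟩

/-- A (unital) topological algebra is simple if it is nonzero and its only closed two-sided ideals
are `0` and the whole algebra. -/
def IsSimpleAlgebra (A : Type*) [Ring A] [TopologicalSpace A] : Prop :=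
  Nontrivial A ∧ ∀ I : TwoSidedIdeal A, IsClosed (I : Set A) → I = ⊥ ∨ I = ⊤

/-! ### Canonical actions -/

/-- `G_Θ = {A ∈ GL_d(ℤ) : Aᵗ Θ A = Θ}`. -/
def isotropyGroup {d : ℕ} (Θ : Matrix (Fin d) (Fin d) ℝ) : Subgroup (GL (Fin d) ℤ) where
  carrier := {A | ((A : Matrix (Fin d) (Fin d) ℤ).map (Int.cast : ℤ → ℝ))ᵀ * Θ *
    (A : Matrix (Fin d) (Fin d) ℤ).map (Int.cast : ℤ → ℝ) = Θ}
  one_mem' := by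
    simp [Matrix.map_one]
  mul_mem' := by
    intro A B hA hB
    have h : ((A * B : GL (Fin d) ℤ) : Matrix (Fin d) (Fin d) ℤ).map (Int.cast : ℤ → ℝ)
        = (A : Matrix (Fin d) (Fin d) ℤ).map (Int.cast : ℤ → ℝ) *
          (B : Matrix (Fin d) (Fin d) ℤ).map (Int.cast : ℤ → ℝ) := by
      rw [Units.val_mul]
      exact Matrix.map_mul (f := Int.castRingHom ℝ)
    simp only [Set.mem_ofPred_eq] at *
    rw [h, Matrix.transpose_mul]
    conv_rhs => rw [← hB, ← hA]
    simp only [Matrix.mul_assoc]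
  inv_mem' := by
    intro A hA
    have h : (A : Matrix (Fin d) (Fin d) ℤ).map (Int.cast : ℤ → ℝ) *
        ((A⁻¹ : GL (Fin d) ℤ) : Matrix (Fin d) (Fin d) ℤ).map (Int.cast : ℤ → ℝ) = 1 := by
      have h1 : (A : Matrix (Fin d) (Fin d) ℤ) * ((A⁻¹ : GL (Fin d) ℤ) :
          Matrix (Fin d) (Fin d) ℤ) = 1 := by rw [← Units.val_mul]; simp
      have h2 := congrArg (Int.castRingHom ℝ).mapMatrix h1
      rw [RingHom.map_mul, RingHom.map_one] at h2
      exact h2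
    simp only [Set.mem_ofPred_eq] at *
    conv_lhs => rw [← hA]
    have h3 := congrArg Matrix.transpose h
    rw [Matrix.transpose_mul, Matrix.transpose_one] at h3
    rw [← Matrix.mul_assoc, ← Matrix.mul_assoc, h3, Matrix.one_mul, Matrix.mul_assoc, h,
      Matrix.mul_one]

/-- The action `α` of the subgroup `G` of `G_Θ` on `A_Θ` by `*`-automorphisms is the canonical one:
`α_A(l_Θ(x)) = l_Θ(A x)` for all `A ∈ G`, `x ∈ ℤ^d`. -/
def IsCanonicalAction {d : ℕ} (Θ : Matrix (Fin d) (Fin d) ℝ) (G : Subgroup (GL (Fin d) ℤ))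
    (α : G →* (Torus Θ ≃⋆ₐ[ℂ] Torus Θ)) : Prop :=
  G ≤ isotropyGroup Θ ∧
    ∀ (A : G) (x : Fin d → ℤ),
      α A (gen Θ x) = gen Θ (((A : GL (Fin d) ℤ) : Matrix (Fin d) (Fin d) ℤ) *ᵥ x)

/-- `A_Θ` admits the canonical action of `G`. -/
def AdmitsCanonicalAction {d : ℕ} (Θ : Matrix (Fin d) (Fin d) ℝ)
    (G : Subgroup (GL (Fin d) ℤ)) : Prop :=
  ∃ α : G →* (Torus Θ ≃⋆ₐ[ℂ] Torus Θ), IsCanonicalAction Θ G α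

/-! ### Companion matrices -/

/-- The `d × d` companion matrix of a monic polynomial `f = a_0 + a_1 x + ⋯ + a_{d-1} x^{d-1} + x^d`:
ones below the diagonal, last column `(-a_0, …, -a_{d-1})`, all other entries `0`. -/
def companionMatrix (d : ℕ) (f : Polynomial ℤ) : Matrix (Fin d) (Fin d) ℤ :=
  Matrix.of fun i j =>
    if (j : ℕ) + 1 = d then -f.coeff i else if (i : ℕ) = j + 1 then 1 else 0

theorem det_companionMatrix (d : ℕ) (f : Polynomial ℤ) :
    (companionMatrix (d + 1) f).det = (-1) ^ (d + 1) * f.coeff 0 := by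
  rw [Matrix.det_succ_row_zero, Finset.sum_eq_single (Fin.last d)]
  · have h : (companionMatrix (d + 1) f).submatrix Fin.succ (Fin.last d).succAbove = 1 := by
      ext i j
      have hj := j.isLt
      simp only [companionMatrix, Matrix.submatrix_apply, Matrix.of_apply, Fin.succAbove_last,
        Fin.val_castSucc, Fin.val_succ, Matrix.one_apply, Fin.ext_iff]
      rw [if_neg (by omega)]
      simp
    rw [h, Matrix.det_one]
    simp [companionMatrix, pow_succ]
  · intro j _ hj
    have : (j : ℕ) ≠ d := fun h => hj (Fin.ext h)
    simp [companionMatrix, this]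
  · simp

/-- `C_p ∈ GL_{p-1}(ℤ)`, the companion matrix of the `p`-th cyclotomic polynomial (`p` prime). -/
def cyclotomicCompanion (p : ℕ) (hp : p.Prime) : GL (Fin (p - 1)) ℤ :=
  Matrix.GeneralLinearGroup.mk'' (companionMatrix (p - 1) (Polynomial.cyclotomic p ℤ)) (by
    obtain ⟨k, hk⟩ : ∃ k, p - 1 = k + 1 := ⟨p - 2, by have := hp.two_le; omega⟩
    rw [hk, det_companionMatrix, Polynomial.cyclotomic_coeff_zero ℤ hp.one_lt, mul_one]
    exact (isUnit_one.neg).pow _)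

/-! ### The forms of the skew symmetric matrix -/

/-- The skew symmetric `d × d` Toeplitz matrix with first row `(0, t_0, t_1, …, t_{d-2})`. -/
def skewToeplitz (d : ℕ) (t : ℕ → ℝ) : Matrix (Fin d) (Fin d) ℝ :=
  Matrix.of fun i j =>
    if (i : ℕ) < j then t (j - i - 1) else if (j : ℕ) < i then -t (i - j - 1) else 0

/-- For an odd prime `p`, the skew symmetric `(p-1) × (p-1)` Toeplitz matrix with first row
`(0, θ_0, θ_1, …, θ_{(p-3)/2}, -θ_{(p-3)/2}, …, -θ_2, -θ_1)`. -/
def primeForm (p : ℕ) (θ : ℕ → ℝ) : Matrix (Fin (p - 1)) (Fin (p - 1)) ℝ :=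
  skewToeplitz (p - 1) fun k => if k < (p - 1) / 2 then θ k else -θ (p - 2 - k)

end NCTorus

end

/-! The existence of a canonical action is a question of linear algebra. The algebra sits in a
product over all twisted representations, so every `A` with `Aᵗ Θ A = Θ` acts by reindexing the
factors along `ρ ↦ ρ ∘ A`. Hence `⟨C⟩` acts canonically exactly when `Cᵗ Θ C = Θ`
(`admitsCanonicalAction_iff`).

A companion matrix sends `e_j` to `e_{j+1}` except for the last `j`, so invariance contains
`Θ_{i+1,j+1} = Θ_{ij}`, which is the Toeplitz property of (a). By skew symmetry the only further
condition comes from the last column (`transpose_mul_mul_eq_iff`). For `Φ_p`, all of whose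
coefficients are `1`, it is a condition on row sums. The entries of `primeForm` are values `s(j -
i)` of an odd function `s` on `ZMod p`, whose total sum is `0`; this gives one direction of (b).
Conversely, the row sums force the partial sums `S` of the Toeplitz symbol `t` to satisfy `S(m) =
S(p-1-m)`, and differencing gives `t_k = -t_{p-2-k}`.

For (c), conjugation by `l(y)` multiplies `l(x)` by `commPairing Θ y x`. If this pairing is
nondegenerate, averaging over powers of such conjugations nearly kills finitely many `l(x)` with `x
≠ 0`, fixes `1`, and preserves ideals. A proper ideal stays at distance at least `|β|` from `β • 1`,
so its elements have zero constant coefficient, expressed here by the mean `dualMean` over the dual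
torus action. Applying this to `a * l(x)` shows that all Fourier coefficients of `a` vanish, so `a =
0` (`isSimpleAlgebra_torus`). Nondegeneracy for `primeForm` is `primeForm_nondegenerate`: linear
independence turns degeneracy into reflection symmetries on `ZMod p` that carry every coordinate to
a position where the vector is `0`. -/

namespace NCTorus

open Finset Matrix

/-! ### Invariance under a companion matrix and the Toeplitz property -/

section Companion

variable {d : ℕ} (f : Polynomial ℤ)

/-- The companion matrix over the reals. -/
noncomputable abbrev realCompanion (d : ℕ) (f : Polynomial ℤ) : Matrix (Fin d) (Fin d) ℝ :=
  (companionMatrix d f).map (Int.cast : ℤ → ℝ)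

theorem mul_realCompanion_of_lt (N : Matrix (Fin d) (Fin d) ℝ) (i j : Fin d)
    (hj : (j : ℕ) + 1 < d) : (N * realCompanion d f) i j = N i ⟨j + 1, hj⟩ := by
  rw [Matrix.mul_apply, Finset.sum_eq_single ⟨j + 1, hj⟩]
  · simp [companionMatrix, hj.ne]
  · intro b _ hb
    have : (b : ℕ) ≠ j + 1 := fun h => hb (Fin.ext h)
    simp [companionMatrix, hj.ne, this]
  · simp

theorem mul_realCompanion_of_eq (N : Matrix (Fin d) (Fin d) ℝ) (i j : Fin d)
    (hj : (j : ℕ) + 1 = d) :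
    (N * realCompanion d f) i j = -∑ b, N i b * (f.coeff b : ℝ) := by
  rw [Matrix.mul_apply, ← Finset.sum_neg_distrib]
  exact Finset.sum_congr rfl fun b _ => by simp [companionMatrix, hj]

/-- Turns the congruence into two right multiplications by `M`, so that column formulas for `N * M`
suffice. -/
theorem transpose_mul_mul_apply (M N : Matrix (Fin d) (Fin d) ℝ) (i j : Fin d) :
    (Mᵀ * N * M) i j = ((N * M)ᵀ * M) j i := by
  rw [Matrix.mul_assoc, ← Matrix.transpose_apply (Mᵀ * (N * M)), Matrix.transpose_mul,
    Matrix.transpose_transpose]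

theorem apply_succ_succ_of_invariant {Θ : Matrix (Fin d) (Fin d) ℝ}
    (h : (realCompanion d f)ᵀ * Θ * realCompanion d f = Θ) (i j : Fin d)
    (hi : (i : ℕ) + 1 < d) (hj : (j : ℕ) + 1 < d) :
    Θ ⟨i + 1, hi⟩ ⟨j + 1, hj⟩ = Θ i j := by
  conv_rhs => rw [← h, transpose_mul_mul_apply, mul_realCompanion_of_lt f _ _ _ hi,
    Matrix.transpose_apply, mul_realCompanion_of_lt f _ _ _ hj]

theorem apply_last_of_invariant {Θ : Matrix (Fin d) (Fin d) ℝ}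
    (h : (realCompanion d f)ᵀ * Θ * realCompanion d f = Θ) (i j : Fin d)
    (hi : (i : ℕ) + 1 < d) (hj : (j : ℕ) + 1 = d) :
    -∑ b, Θ ⟨i + 1, hi⟩ b * (f.coeff b : ℝ) = Θ i j := by
  conv_rhs => rw [← h, transpose_mul_mul_apply, mul_realCompanion_of_lt f _ _ _ hi,
    Matrix.transpose_apply, mul_realCompanion_of_eq f _ _ _ hj]

theorem apply_swap_of_transpose {Θ : Matrix (Fin d) (Fin d) ℝ} (hΘ : Θᵀ = -Θ) (i j : Fin d) :
    Θ i j = -Θ j i := by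
  rw [← Matrix.transpose_apply Θ j i, hΘ, Matrix.neg_apply]

theorem transpose_mul_mul_eq_iff {Θ : Matrix (Fin d) (Fin d) ℝ} (hΘ : Θᵀ = -Θ) :
    (realCompanion d f)ᵀ * Θ * realCompanion d f = Θ ↔
      (∀ (i j : Fin d) (hi : (i : ℕ) + 1 < d) (hj : (j : ℕ) + 1 < d),
        Θ ⟨i + 1, hi⟩ ⟨j + 1, hj⟩ = Θ i j) ∧
      (∀ (i j : Fin d) (hi : (i : ℕ) + 1 < d) (_ : (j : ℕ) + 1 = d),
        -∑ b, Θ ⟨i + 1, hi⟩ b * (f.coeff b : ℝ) = Θ i j) := by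
  refine ⟨fun h => ⟨apply_succ_succ_of_invariant f h, apply_last_of_invariant f h⟩, ?_⟩
  rintro ⟨h1, h2⟩
  set N := (realCompanion d f)ᵀ * Θ * realCompanion d f with hN
  have hNt : Nᵀ = -N := by
    rw [hN, Matrix.transpose_mul, Matrix.transpose_mul, Matrix.transpose_transpose, hΘ]
    simp [Matrix.mul_assoc]
  have key : ∀ i j : Fin d, (i : ℕ) + 1 < d → N i j = Θ i j := by
    intro i j hi
    rw [hN, transpose_mul_mul_apply, mul_realCompanion_of_lt f _ _ _ hi, Matrix.transpose_apply]
    rcases (Nat.succ_le_of_lt j.isLt).lt_or_eq with hj | hj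
    · rw [mul_realCompanion_of_lt f _ _ _ hj, h1 i j hi hj]
    · rw [mul_realCompanion_of_eq f _ _ _ hj, h2 i j hi hj]
  ext i j
  -- Both sides are skew, so the last row follows from the last column and the corner entry is `0`.
  rcases (Nat.succ_le_of_lt i.isLt).lt_or_eq with hi | hi
  · exact key i j hi
  rcases (Nat.succ_le_of_lt j.isLt).lt_or_eq with hj | hj
  · rw [apply_swap_of_transpose hNt, apply_swap_of_transpose hΘ, key j i hj]
  · have : i = j := Fin.ext (by simpa using hi.trans hj.symm)
    subst this
    have a := apply_swap_of_transpose hNt i i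
    have b := apply_swap_of_transpose hΘ i i
    linarith

/-- Sliding along a diagonal reaches row `0`, from which the symbol is read off. The default `0` is
never used, since entries of the matrix only involve `k + 1 < d`. -/
theorem eq_skewToeplitz_of_succ_succ {Θ : Matrix (Fin d) (Fin d) ℝ} (hΘ : Θᵀ = -Θ)
    (h : ∀ (i j : Fin d) (hi : (i : ℕ) + 1 < d) (hj : (j : ℕ) + 1 < d),
      Θ ⟨i + 1, hi⟩ ⟨j + 1, hj⟩ = Θ i j) :
    Θ = skewToeplitz d fun k =>
      if hk : k + 1 < d then Θ ⟨0, by omega⟩ ⟨k + 1, hk⟩ else 0 := by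
  have key : ∀ (m k : ℕ) (hm : m + k < d),
      Θ ⟨m, by omega⟩ ⟨m + k, hm⟩ = Θ ⟨0, by omega⟩ ⟨k, by omega⟩ := by
    intro m
    induction m with
    | zero => intro k hm; simp
    | succ m ih =>
      intro k hm
      have h1 : m + 1 < d := by omega
      have h2 : m + k + 1 < d := by omega
      rw [← ih k (by omega), ← h ⟨m, by omega⟩ ⟨m + k, by omega⟩ h1 h2]
      congr 1
      exact Fin.ext (by simp only; omega)
  have lt : ∀ i j : Fin d, (i : ℕ) < j →
      Θ i j = if hk : (j : ℕ) - i - 1 + 1 < d then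
        Θ ⟨0, by omega⟩ ⟨(j : ℕ) - i - 1 + 1, hk⟩ else 0 := by
    intro i j hij
    have hj := j.isLt
    rw [dif_pos (by omega), ← key i _ (by omega)]
    congr 1
    exact Fin.ext (by simp only; omega)
  ext i j
  simp only [skewToeplitz, Matrix.of_apply]
  by_cases h1 : (i : ℕ) < j
  · rw [if_pos h1, lt i j h1]
  by_cases h2 : (j : ℕ) < i
  · rw [if_neg h1, if_pos h2, apply_swap_of_transpose hΘ, lt j i h2]
  · rw [if_neg h1, if_neg h2]
    have : i = j := Fin.ext (by omega)
    subst this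
    linarith [apply_swap_of_transpose hΘ i i]

end Companion

/-! ### The prime form as an odd function on `ZMod p` -/

section Cyclic

variable {p : ℕ}

/-- The odd function on `ZMod p` with values `θ k` at `k + 1`, for `k < (p - 1) / 2`. -/
noncomputable def oddSymbol (p : ℕ) (θ : ℕ → ℝ) (w : ZMod p) : ℝ :=
  ∑ k ∈ range ((p - 1) / 2),
    θ k * ((if w = ((k + 1 : ℕ) : ZMod p) then 1 else 0) -
      (if w = -((k + 1 : ℕ) : ZMod p) then 1 else 0))

theorem oddSymbol_neg (θ : ℕ → ℝ) (w : ZMod p) : oddSymbol p θ (-w) = -oddSymbol p θ w := by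
  simp only [oddSymbol, ← Finset.sum_neg_distrib]
  refine Finset.sum_congr rfl fun k _ => ?_
  simp only [neg_eq_iff_eq_neg (a := w), neg_neg]
  ring

theorem oddSymbol_zero (θ : ℕ → ℝ) : oddSymbol p θ 0 = 0 := by
  have := oddSymbol_neg (p := p) θ 0
  rw [neg_zero] at this
  linarith

theorem natCast_eq_natCast_iff_of_lt {a b : ℕ} (ha : a < p) (hb : b < p) :
    ((a : ℕ) : ZMod p) = (b : ZMod p) ↔ a = b := by
  rw [ZMod.natCast_eq_natCast_iff']
  rw [Nat.mod_eq_of_lt ha, Nat.mod_eq_of_lt hb]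

theorem natCast_eq_neg_natCast_iff {a b : ℕ} (ha : a < p) (hb : b < p) (ha0 : 0 < a) :
    ((a : ℕ) : ZMod p) = -(b : ZMod p) ↔ a + b = p := by
  rw [eq_neg_iff_add_eq_zero, ← Nat.cast_add, ZMod.natCast_eq_zero_iff]
  constructor
  · rintro ⟨c, hc⟩
    have h1 : c < 2 := by
      by_contra hcon
      have : p * 2 ≤ p * c := Nat.mul_le_mul_left p (by omega)
      omega
    have h2 : c ≠ 0 := by rintro rfl; omega
    obtain rfl : c = 1 := by omega
    omega
  · rintro h
    rw [h]

theorem oddSymbol_natCast (hodd : Odd p) (θ : ℕ → ℝ) {m : ℕ} (hm0 : 0 < m) (hm : m < p) :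
    oddSymbol p θ (m : ZMod p) =
      if m ≤ (p - 1) / 2 then θ (m - 1) else -θ (p - 1 - m) := by
  obtain ⟨q, rfl⟩ := hodd
  have hq : (2 * q + 1 - 1) / 2 = q := by omega
  simp only [oddSymbol, hq]
  have key : ∀ k ∈ range q, θ k * ((if (m : ZMod (2 * q + 1)) = ((k + 1 : ℕ) : ZMod (2 * q + 1))
      then (1 : ℝ) else 0) - (if (m : ZMod (2 * q + 1)) = -((k + 1 : ℕ) : ZMod (2 * q + 1))
      then 1 else 0)) =
      θ k * ((if m = k + 1 then 1 else 0) - (if m + (k + 1) = 2 * q + 1 then 1 else 0)) := by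
    intro k hk
    have := Finset.mem_range.1 hk
    simp only [natCast_eq_natCast_iff_of_lt hm (show k + 1 < 2 * q + 1 by omega),
      natCast_eq_neg_natCast_iff hm (show k + 1 < 2 * q + 1 by omega) hm0]
  rw [Finset.sum_congr rfl key]
  split_ifs with h
  · rw [Finset.sum_eq_single (m - 1)]
    · rw [if_pos (by omega), if_neg (by omega)]; ring
    · intro b hb hbm
      have := Finset.mem_range.1 hb
      rw [if_neg (by omega), if_neg (by omega)]; ring
    · intro hb
      exact absurd (Finset.mem_range.2 (by omega)) hb
  · rw [Finset.sum_eq_single (2 * q + 1 - 1 - m)]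
    · rw [if_neg (by omega), if_pos (by omega)]; ring
    · intro b hb hbm
      have := Finset.mem_range.1 hb
      rw [if_neg (by omega), if_neg (by omega)]; ring
    · intro hb
      exact absurd (Finset.mem_range.2 (by omega)) hb

theorem primeForm_apply (hodd : Odd p) (θ : ℕ → ℝ) (i j : Fin (p - 1)) :
    primeForm p θ i j = oddSymbol p θ ((j : ℕ) - (i : ℕ) : ZMod p) := by
  have aux : ∀ i j : Fin (p - 1), (i : ℕ) < j →
      oddSymbol p θ ((j : ℕ) - (i : ℕ) : ZMod p) =
        if (j : ℕ) - i - 1 < (p - 1) / 2 then θ (j - i - 1) else -θ (p - 2 - (j - i - 1)) := by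
    intro i j h
    have hj := j.isLt
    rw [← Nat.cast_sub h.le, oddSymbol_natCast hodd θ (by omega) (by omega)]
    by_cases hk : (j : ℕ) - i ≤ (p - 1) / 2
    · rw [if_pos hk, if_pos (by omega)]
    · rw [if_neg hk, if_neg (by omega)]
      congr 2
      omega
  simp only [primeForm, skewToeplitz, Matrix.of_apply]
  split_ifs with h1 h2 h3 h4
  · rw [aux i j h1, if_pos h2]
  · rw [aux i j h1, if_neg h2]
  · rw [← neg_sub, oddSymbol_neg, aux j i h3, if_pos h4]
  · rw [← neg_sub, oddSymbol_neg, aux j i h3, if_neg h4]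
  · have : i = j := Fin.ext (by omega)
    subst this
    rw [sub_self, oddSymbol_zero]

/-- The indices `0, …, p - 2` miss exactly the residue `p - 1 = -1`. -/
theorem sum_fin_pred_add (hp : 0 < p) [NeZero p] (F : ZMod p → ℝ) :
    ∑ b : Fin (p - 1), F ((b : ℕ) : ZMod p) + F (-1) = ∑ z, F z := by
  obtain ⟨n, rfl⟩ : ∃ n, p = n + 1 := ⟨p - 1, by omega⟩
  have h1 : (-1 : ZMod (n + 1)) = ((n : ℕ) : ZMod (n + 1)) := by
    rw [neg_eq_iff_add_eq_zero, add_comm 1]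
    exact_mod_cast ZMod.natCast_self (n + 1)
  have h2 : ∑ z : ZMod (n + 1), F z = ∑ b ∈ range (n + 1), F ((b : ℕ) : ZMod (n + 1)) := by
    refine Finset.sum_nbij' (fun z => z.val) (fun b => (b : ZMod (n + 1))) ?_ ?_ ?_ ?_ ?_
    · intro z _; exact Finset.mem_range.2 (ZMod.val_lt z)
    · intro b _; exact Finset.mem_univ _
    · intro z _; exact ZMod.natCast_zmod_val z
    · intro b hb; exact ZMod.val_cast_of_lt (Finset.mem_range.1 hb)
    · intro z _; rw [ZMod.natCast_zmod_val z]
  rw [h2, Finset.sum_range_succ, h1]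
  congr 1
  exact Fin.sum_univ_eq_sum_range (fun b => F ((b : ℕ) : ZMod (n + 1))) n

theorem sum_oddSymbol_sub [NeZero p] (θ : ℕ → ℝ) (c : ZMod p) :
    ∑ z, oddSymbol p θ (z - c) = 0 := by
  have h1 : ∑ z, oddSymbol p θ (z - c) = ∑ z, oddSymbol p θ z :=
    (Equiv.subRight c).sum_comp (oddSymbol p θ)
  have h2 : ∑ z, oddSymbol p θ z = ∑ z, oddSymbol p θ (-z) :=
    (Equiv.sum_comp (Equiv.neg (ZMod p)) (oddSymbol p θ)).symm
  simp only [oddSymbol_neg, Finset.sum_neg_distrib] at h2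
  linarith

theorem primeForm_transpose (θ : ℕ → ℝ) : (primeForm p θ)ᵀ = -primeForm p θ := by
  ext i j
  simp only [primeForm, skewToeplitz, Matrix.of_apply, Matrix.transpose_apply, Matrix.neg_apply]
  by_cases h1 : (i : ℕ) < j
  · simp [h1, h1.not_gt]
  · by_cases h2 : (j : ℕ) < i
    · simp [h1, h2]
    · simp [h1, h2]

theorem cyclotomic_coeff_of_lt (hp : p.Prime) {b : ℕ} (hb : b < p) :
    (Polynomial.cyclotomic p ℤ).coeff b = 1 := by
  have := Fact.mk hp
  rw [Polynomial.cyclotomic_prime, Polynomial.finsetSum_coeff]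
  simp [Polynomial.coeff_X_pow, hb]

/-- A row sum is the full sum of a translated odd function, which is `0`, minus its value at `-1`;
that value is the required entry of the last column. -/
theorem primeForm_invariant (hp : p.Prime) (h3 : 3 ≤ p) (θ : ℕ → ℝ) :
    (realCompanion (p - 1) (Polynomial.cyclotomic p ℤ))ᵀ * primeForm p θ *
      realCompanion (p - 1) (Polynomial.cyclotomic p ℤ) = primeForm p θ := by
  have hodd : Odd p := hp.odd_of_ne_two (by omega)
  have : NeZero p := ⟨hp.ne_zero⟩
  rw [transpose_mul_mul_eq_iff _ (primeForm_transpose θ)]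
  constructor
  · intro i j hi hj
    rw [primeForm_apply hodd, primeForm_apply hodd]
    congr 1
    push_cast
    ring
  · intro i j hi hj
    have h1 := sum_fin_pred_add hp.pos (fun z => oddSymbol p θ (z - ((i : ℕ) + 1)))
    rw [sum_oddSymbol_sub] at h1
    have h2 : ∑ b : Fin (p - 1), primeForm p θ ⟨i + 1, hi⟩ b *
        ((Polynomial.cyclotomic p ℤ).coeff b : ℝ) =
        ∑ b : Fin (p - 1), oddSymbol p θ ((b : ℕ) - ((i : ℕ) + 1)) := by
      refine Finset.sum_congr rfl fun b _ => ?_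
      have hb := b.isLt
      rw [cyclotomic_coeff_of_lt hp (by omega), primeForm_apply hodd]
      simp
    -- The last index of `Fin (p - 1)` is `p - 2`.
    have hj' : ((j : ℕ) : ZMod p) = -2 := by
      rw [eq_neg_iff_add_eq_zero]
      have : ((j : ℕ) : ZMod p) + 2 = (((j : ℕ) + 2 : ℕ) : ZMod p) := by push_cast; rfl
      rw [this, show (j : ℕ) + 2 = p by omega]
      exact ZMod.natCast_self p
    rw [h2, primeForm_apply hodd, hj']
    have : (-1 - ((i : ℕ) + 1) : ZMod p) = -2 - (i : ℕ) := by ring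
    rw [this] at h1
    linarith

theorem exists_eq_primeForm_of_invariant (hp : p.Prime) (h3 : 3 ≤ p)
    {Θ : Matrix (Fin (p - 1)) (Fin (p - 1)) ℝ} (hΘ : Θᵀ = -Θ)
    (h : (realCompanion (p - 1) (Polynomial.cyclotomic p ℤ))ᵀ * Θ *
      realCompanion (p - 1) (Polynomial.cyclotomic p ℤ) = Θ) :
    ∃ θ : ℕ → ℝ, Θ = primeForm p θ := by
  obtain ⟨hT, hL⟩ := (transpose_mul_mul_eq_iff _ hΘ).1 h
  have hΘt := eq_skewToeplitz_of_succ_succ hΘ hT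
  set t : ℕ → ℝ := fun k =>
      if hk : k + 1 < p - 1 then Θ ⟨0, by omega⟩ ⟨k + 1, hk⟩ else 0 with ht
  refine ⟨t, ?_⟩
  have row : ∀ i : Fin (p - 1), ∑ b, Θ i b = ∑ b ∈ range i, -t (i - b - 1) +
      ∑ b ∈ range (p - 1 - (i + 1)), t b := by
    intro i
    have hi := i.isLt
    rw [hΘt]
    simp only [skewToeplitz, Matrix.of_apply]
    rw [Fin.sum_univ_eq_sum_range (fun b => if (i : ℕ) < b then t (b - i - 1) else
      if b < (i : ℕ) then -t (i - b - 1) else 0) (p - 1),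
      show range (p - 1) = range (((i : ℕ) + 1) + (p - 1 - (i + 1))) by congr 1; omega,
      Finset.sum_range_add, Finset.sum_range_succ]
    congr 1
    · simp only [lt_irrefl, if_false, add_zero]
      refine Finset.sum_congr rfl fun b hb => ?_
      have := Finset.mem_range.1 hb
      rw [if_neg (by omega), if_pos this]
    · refine Finset.sum_congr rfl fun b _ => ?_
      rw [if_pos (by omega)]
      congr 1
      omega
  -- The last-column equation for row `i`: the entry on its right-hand side lengthens the second
  -- partial sum by one term, giving `S(m) = S(p - 1 - m)` with `m = i + 1`.
  have row' : ∀ i : ℕ, ∀ hi : i + 1 < p - 1, ∑ b ∈ range (i + 1), t b =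
      ∑ b ∈ range (p - 1 - (i + 1)), t b := by
    intro i hi
    have e := hL ⟨i, by omega⟩ ⟨p - 2, by omega⟩ hi (by simp only; omega)
    have h1 : ∑ b : Fin (p - 1), Θ ⟨i + 1, hi⟩ b *
        ((Polynomial.cyclotomic p ℤ).coeff b : ℝ) = ∑ b, Θ ⟨i + 1, hi⟩ b :=
      Finset.sum_congr rfl fun b _ => by
        have hb := b.isLt
        rw [cyclotomic_coeff_of_lt hp (by omega)]; simp
    have h2 : Θ ⟨i, by omega⟩ ⟨p - 2, by omega⟩ = t (p - 1 - (i + 1) - 1) := by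
      conv_lhs => rw [hΘt]
      simp only [skewToeplitz, Matrix.of_apply]
      rw [if_pos (by omega)]
      congr 1
      omega
    have h4 : ∑ b ∈ range (i + 1), -t (i + 1 - b - 1) = -∑ b ∈ range (i + 1), t b := by
      rw [Finset.sum_neg_distrib, ← Finset.sum_range_reflect t (i + 1)]
      congr 1
      refine Finset.sum_congr rfl fun b _ => ?_
      congr 1
      omega
    have h5 : ∑ b ∈ range (p - 1 - (i + 1)), t b =
        ∑ b ∈ range (p - 1 - (i + 1 + 1)), t b + t (p - 1 - (i + 1) - 1) := by
      rw [show p - 1 - (i + 1) = (p - 1 - (i + 1 + 1)) + 1 by omega, Finset.sum_range_succ]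
      rfl
    rw [h1, row, h2] at e
    simp only at e
    rw [h4] at e
    rw [h5]
    linarith
  -- Subtract the partial-sum identities for `m = k + 1` and `m = k`.
  have sym : ∀ k, 0 < k → k + 1 < p - 1 → t k = -t (p - 2 - k) := by
    intro k hk hk1
    have e1 := row' k hk1
    have e2 := row' (k - 1) (by omega)
    rw [Finset.sum_range_succ] at e1
    rw [show k - 1 + 1 = k by omega,
      show p - 1 - k = (p - 1 - (k + 1)) + 1 by omega, Finset.sum_range_succ] at e2
    rw [show p - 2 - k = p - 1 - (k + 1) by omega]
    linarith
  conv_lhs => rw [hΘt]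
  have hodd : Odd p := hp.odd_of_ne_two (by omega)
  have main : ∀ k, k + 1 < p - 1 → t k = if k < (p - 1) / 2 then t k else -t (p - 2 - k) := by
    intro k hk
    split_ifs with h
    · rfl
    · exact sym k (by omega) hk
  ext i j
  have hi := i.isLt
  have hj := j.isLt
  simp only [primeForm, skewToeplitz, Matrix.of_apply]
  by_cases h1 : (i : ℕ) < j
  · rw [if_pos h1, if_pos h1]
    exact main _ (by omega)
  · by_cases h2 : (j : ℕ) < i
    · rw [if_neg h1, if_neg h1, if_pos h2, if_pos h2]
      exact congrArg Neg.neg (main _ (by omega))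
    · rw [if_neg h1, if_neg h1, if_neg h2, if_neg h2]

end Cyclic

/-! ### Endomorphisms induced by cocycle-preserving maps -/

section Pullback

variable {d : ℕ} {Θ : Matrix (Fin d) (Fin d) ℝ}

theorem omega_mulVec {A : Matrix (Fin d) (Fin d) ℤ}
    (hA : (A.map (Int.cast : ℤ → ℝ))ᵀ * Θ * A.map (Int.cast : ℤ → ℝ) = Θ) (x y : Fin d → ℤ) :
    omega Θ (A *ᵥ x) (A *ᵥ y) = omega Θ x y := by
  have h : ∀ x : Fin d → ℤ, (fun i => ((A *ᵥ x) i : ℝ)) =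
      A.map (Int.cast : ℤ → ℝ) *ᵥ fun i => (x i : ℝ) := by
    intro x
    ext i
    simp [Matrix.mulVec, dotProduct]
  unfold omega
  rw [h, h, Matrix.mulVec_mulVec, dotProduct_comm, ← Matrix.vecMul_transpose,
    ← Matrix.dotProduct_mulVec, Matrix.mulVec_mulVec, ← Matrix.mul_assoc, hA, dotProduct_comm]

/-- Precomposition of a twisted representation with a map preserving the cocycle. -/
abbrev TwistedRep.comp (ρ : TwistedRep Θ) (φ : (Fin d → ℤ) →+ (Fin d → ℤ))
    (h : ∀ x y, omega Θ (φ x) (φ y) = omega Θ x y) : TwistedRep Θ where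
  H := ρ.H
  v x := ρ.v (φ x)
  map_mul x y := by rw [ρ.map_mul, h, map_add]

/-- The endomorphism `T ↦ (T_{ρ ∘ φ})_ρ` of the algebra of bounded families. -/
noncomputable def familyPullback (φ : (Fin d → ℤ) →+ (Fin d → ℤ))
    (h : ∀ x y, omega Θ (φ x) (φ y) = omega Θ x y) :
    BoundedFamilies Θ →⋆ₐ[ℂ] BoundedFamilies Θ where
  toFun T := ⟨fun ρ => (T : ∀ ρ : TwistedRep Θ, ρ.H →L[ℂ] ρ.H) (ρ.comp φ h),
    memℓp_infty ⟨‖T‖, by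
      rintro _ ⟨ρ, rfl⟩
      exact lp.norm_apply_le_norm ENNReal.top_ne_zero T (ρ.comp φ h)⟩⟩
  -- These hold definitionally: `ρ.comp φ h` has the same Hilbert space as `ρ`, and the operations
  -- on families are pointwise.
  map_one' := rfl
  map_mul' _ _ := rfl
  map_zero' := rfl
  map_add' _ _ := rfl
  commutes' _ := rfl
  map_star' _ := rfl

theorem norm_familyPullback_le (φ : (Fin d → ℤ) →+ (Fin d → ℤ))
    (h : ∀ x y, omega Θ (φ x) (φ y) = omega Θ x y) (T : BoundedFamilies Θ) :
    ‖familyPullback φ h T‖ ≤ ‖T‖ :=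
  lp.norm_le_of_forall_le (norm_nonneg _) fun ρ =>
    lp.norm_apply_le_norm ENNReal.top_ne_zero T (ρ.comp φ h)

theorem continuous_familyPullback (φ : (Fin d → ℤ) →+ (Fin d → ℤ))
    (h : ∀ x y, omega Θ (φ x) (φ y) = omega Θ x y) : Continuous (familyPullback φ h) :=
  AddMonoidHomClass.continuous_of_bound (familyPullback φ h) 1 fun T => by
    simpa using norm_familyPullback_le φ h T

theorem familyPullback_mem (φ : (Fin d → ℤ) →+ (Fin d → ℤ))
    (h : ∀ x y, omega Θ (φ x) (φ y) = omega Θ x y) {T : BoundedFamilies Θ} (hT : T ∈ Torus Θ) :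
    familyPullback φ h T ∈ Torus Θ := by
  have h1 := StarSubalgebra.map_topologicalClosure_le
    (StarAlgebra.adjoin ℂ (Set.range (universalRep Θ))) _ (continuous_familyPullback φ h)
  have h2 : familyPullback φ h T ∈ StarSubalgebra.map (familyPullback φ h) (Torus Θ) :=
    ⟨T, hT, rfl⟩
  refine StarSubalgebra.topologicalClosure_mono ?_ (h1 h2)
  rw [StarAlgHom.map_adjoin]
  refine StarAlgebra.adjoin_mono ?_
  rintro _ ⟨_, ⟨x, rfl⟩, rfl⟩
  exact ⟨φ x, rfl⟩

/-- The endomorphism `l_Θ(x) ↦ l_Θ(φ x)` of the noncommutative torus. -/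
noncomputable def torusPullback (φ : (Fin d → ℤ) →+ (Fin d → ℤ))
    (h : ∀ x y, omega Θ (φ x) (φ y) = omega Θ x y) : Torus Θ →⋆ₐ[ℂ] Torus Θ :=
  ((familyPullback φ h).comp (Torus Θ).subtype).codRestrict (Torus Θ) fun T =>
    familyPullback_mem φ h T.2

theorem continuous_torusPullback (φ : (Fin d → ℤ) →+ (Fin d → ℤ))
    (h : ∀ x y, omega Θ (φ x) (φ y) = omega Θ x y) : Continuous (torusPullback φ h) :=
  Continuous.subtype_mk ((continuous_familyPullback φ h).comp continuous_subtype_val) _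

theorem torus_starAlgHom_ext {φ ψ : Torus Θ →⋆ₐ[ℂ] Torus Θ} (hφ : Continuous φ)
    (hψ : Continuous ψ) (h : ∀ x, φ (gen Θ x) = ψ (gen Θ x)) : φ = ψ := by
  refine StarAlgHom.ext_topologicalClosure hφ hψ (StarAlgHom.ext_adjoin fun a ha => ?_)
  obtain ⟨x, hx⟩ := ha
  have : StarSubalgebra.inclusion (StarSubalgebra.le_topologicalClosure _) a = gen Θ x :=
    Subtype.ext hx.symm
  simp only [StarAlgHom.comp_apply, this, h x]

end Pullback

/-! ### The canonical action of the isotropy group -/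

section Action

variable {d : ℕ} {Θ : Matrix (Fin d) (Fin d) ℝ}

/-- The endomorphism `l_Θ(x) ↦ l_Θ(A x)` for `A` in the isotropy group of `Θ`. -/
noncomputable def isotropyHom (A : isotropyGroup Θ) : Torus Θ →⋆ₐ[ℂ] Torus Θ :=
  torusPullback (Matrix.mulVecLin (A : GL (Fin d) ℤ).1).toAddMonoidHom (omega_mulVec A.2)

theorem isotropyHom_gen (A : isotropyGroup Θ) (x : Fin d → ℤ) :
    isotropyHom A (gen Θ x) = gen Θ ((A : GL (Fin d) ℤ).1 *ᵥ x) := rfl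

theorem isotropyHom_comp (A B : isotropyGroup Θ) :
    (isotropyHom A).comp (isotropyHom B) = isotropyHom (A * B) := by
  refine torus_starAlgHom_ext ((continuous_torusPullback _ _).comp (continuous_torusPullback _ _))
    (continuous_torusPullback _ _) fun x => ?_
  simp only [StarAlgHom.comp_apply, isotropyHom_gen, Matrix.mulVec_mulVec]
  rfl

theorem isotropyHom_one : isotropyHom (1 : isotropyGroup Θ) = .id ℂ (Torus Θ) := by
  refine torus_starAlgHom_ext (continuous_torusPullback _ _) continuous_id fun x => ?_
  rw [isotropyHom_gen]
  simp

/-- The canonical action of the isotropy group on the noncommutative torus. -/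
noncomputable def isotropyAction (Θ : Matrix (Fin d) (Fin d) ℝ) :
    isotropyGroup Θ →* (Torus Θ ≃⋆ₐ[ℂ] Torus Θ) :=
  MonoidHom.mk' (fun A => StarAlgEquiv.ofStarAlgHom (isotropyHom A) (isotropyHom A⁻¹)
      (by rw [isotropyHom_comp, inv_mul_cancel, isotropyHom_one])
      (by rw [isotropyHom_comp, mul_inv_cancel, isotropyHom_one])) fun A B => by
    ext1 T
    exact (DFunLike.congr_fun (isotropyHom_comp A B) T).symm

theorem admitsCanonicalAction_iff {G : Subgroup (GL (Fin d) ℤ)} :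
    AdmitsCanonicalAction Θ G ↔ G ≤ isotropyGroup Θ := by
  refine ⟨fun ⟨_, h, _⟩ => h, fun h => ?_⟩
  exact ⟨(isotropyAction Θ).comp (Subgroup.inclusion h), h, fun A x => rfl⟩

theorem admitsCanonicalAction_zpowers_iff {C : GL (Fin d) ℤ} :
    AdmitsCanonicalAction Θ (Subgroup.zpowers C) ↔
      ((C : Matrix (Fin d) (Fin d) ℤ).map (Int.cast : ℤ → ℝ))ᵀ * Θ *
        (C : Matrix (Fin d) (Fin d) ℤ).map (Int.cast : ℤ → ℝ) = Θ := by
  rw [admitsCanonicalAction_iff, Subgroup.zpowers_le]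
  rfl

end Action

/-! ### The cocycle as a bicharacter -/

section Cocycle

variable {d : ℕ} {Θ : Matrix (Fin d) (Fin d) ℝ}

theorem omega_add_left (x y z : Fin d → ℤ) :
    omega Θ (x + y) z = omega Θ x z * omega Θ y z := by
  have h : (fun i => (((x + y) i : ℤ) : ℝ)) = (fun i => (x i : ℝ)) + fun i => (y i : ℝ) := by
    ext i; simp
  unfold omega
  rw [h, Matrix.mulVec_add, add_dotProduct, mul_add, Circle.exp_add]

theorem omega_add_right (x y z : Fin d → ℤ) :
    omega Θ x (y + z) = omega Θ x y * omega Θ x z := by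
  have h : (fun i => (((y + z) i : ℤ) : ℝ)) = (fun i => (y i : ℝ)) + fun i => (z i : ℝ) := by
    ext i; simp
  unfold omega
  rw [h, dotProduct_add, mul_add, Circle.exp_add]

theorem omega_zero_left (x : Fin d → ℤ) : omega Θ 0 x = 1 := by
  simpa using omega_add_left (Θ := Θ) 0 0 x

theorem omega_zero_right (x : Fin d → ℤ) : omega Θ x 0 = 1 := by
  simpa using omega_add_right (Θ := Θ) x 0 0

theorem omega_neg_right (x y : Fin d → ℤ) : omega Θ x (-y) = (omega Θ x y)⁻¹ := by
  rw [eq_inv_iff_mul_eq_one, ← omega_add_right, neg_add_cancel, omega_zero_right]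

theorem dotProduct_swap_of_skew (hΘ : Θᵀ = -Θ) (u v : Fin d → ℝ) :
    (Θ *ᵥ u) ⬝ᵥ v = -((Θ *ᵥ v) ⬝ᵥ u) := by
  rw [dotProduct_comm, Matrix.dotProduct_mulVec, ← Matrix.mulVec_transpose, hΘ,
    Matrix.neg_mulVec, neg_dotProduct]

theorem omega_swap (hΘ : Θᵀ = -Θ) (x y : Fin d → ℤ) : omega Θ x y = (omega Θ y x)⁻¹ := by
  unfold omega
  rw [dotProduct_swap_of_skew hΘ, mul_neg, Circle.exp_neg]

end Cocycle

/-! ### Relations and density of the span of the canonical unitaries -/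

section Generators

variable {d : ℕ} {Θ : Matrix (Fin d) (Fin d) ℝ}

theorem universalRep_mul (x y : Fin d → ℤ) :
    universalRep Θ x * universalRep Θ y = (omega Θ x y : ℂ) • universalRep Θ (x + y) :=
  lp.ext (funext fun ρ => ρ.map_mul x y)

theorem universalRep_star_mul (x : Fin d → ℤ) :
    star (universalRep Θ x) * universalRep Θ x = 1 :=
  lp.ext (funext fun ρ => Unitary.coe_star_mul_self (ρ.v x))

theorem universalRep_mul_star (x : Fin d → ℤ) :
    universalRep Θ x * star (universalRep Θ x) = 1 :=
  lp.ext (funext fun ρ => Unitary.coe_mul_star_self (ρ.v x))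

theorem universalRep_zero : universalRep Θ 0 = 1 := by
  have h := universalRep_mul (Θ := Θ) 0 0
  rw [omega_zero_left, add_zero, Circle.coe_one, one_smul] at h
  calc universalRep Θ 0 = star (universalRep Θ 0) * universalRep Θ 0 * universalRep Θ 0 := by
        rw [universalRep_star_mul, one_mul]
    _ = 1 := by rw [mul_assoc, h, universalRep_star_mul]

theorem star_universalRep (x : Fin d → ℤ) :
    star (universalRep Θ x) = ((omega Θ x (-x))⁻¹ : ℂ) • universalRep Θ (-x) := by
  have h := universalRep_mul (Θ := Θ) x (-x)
  rw [add_neg_cancel, universalRep_zero] at h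
  have h2 : universalRep Θ (-x) = (omega Θ x (-x) : ℂ) • star (universalRep Θ x) := by
    calc universalRep Θ (-x)
        = star (universalRep Θ x) * (universalRep Θ x * universalRep Θ (-x)) := by
          rw [← mul_assoc, universalRep_star_mul, one_mul]
      _ = _ := by rw [h, mul_smul_comm, mul_one]
  rw [h2, smul_smul, inv_mul_cancel₀ (Circle.coe_ne_zero _), one_smul]

theorem norm_universalRep_le (x : Fin d → ℤ) : ‖universalRep Θ x‖ ≤ 1 :=
  lp.norm_le_of_forall_le zero_le_one fun ρ => (CStarRing.norm_coe_unitary (ρ.v x)).le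

theorem universalRep_mul_mem_span {a : BoundedFamilies Θ}
    (ha : a ∈ Submodule.span ℂ (Set.range (universalRep Θ))) (x : Fin d → ℤ) :
    universalRep Θ x * a ∈ Submodule.span ℂ (Set.range (universalRep Θ)) := by
  induction ha using Submodule.span_induction with
  | mem a ha =>
    obtain ⟨y, rfl⟩ := ha
    rw [universalRep_mul]
    exact Submodule.smul_mem _ _ (Submodule.subset_span ⟨_, rfl⟩)
  | zero => rw [mul_zero]; exact Submodule.zero_mem _
  | add a b _ _ ha hb => rw [mul_add]; exact Submodule.add_mem _ ha hb
  | smul c a _ ha => rw [mul_smul_comm]; exact Submodule.smul_mem _ _ ha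

/-- Products and adjoints of generators are scalar multiples of generators, so their linear span is
already a star subalgebra. -/
theorem mem_span_of_mem_adjoin {a : BoundedFamilies Θ}
    (ha : a ∈ StarAlgebra.adjoin ℂ (Set.range (universalRep Θ))) :
    a ∈ Submodule.span ℂ (Set.range (universalRep Θ)) := by
  induction ha using StarAlgebra.adjoin_induction with
  | mem a ha => exact Submodule.subset_span ha
  | algebraMap r =>
    rw [Algebra.algebraMap_eq_smul_one, ← universalRep_zero]
    exact Submodule.smul_mem _ _ (Submodule.subset_span ⟨_, rfl⟩)
  | add a b _ _ ha hb => exact Submodule.add_mem _ ha hb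
  | mul a b ha' hb' ha hb =>
    clear ha' hb'
    induction ha using Submodule.span_induction with
    | mem a ha =>
      obtain ⟨x, rfl⟩ := ha
      exact universalRep_mul_mem_span hb x
    | zero => rw [zero_mul]; exact Submodule.zero_mem _
    | add a b _ _ ha hb => rw [add_mul]; exact Submodule.add_mem _ ha hb
    | smul c a _ ha => rw [smul_mul_assoc]; exact Submodule.smul_mem _ _ ha
  | star a ha' ha =>
    clear ha'
    induction ha using Submodule.span_induction with
    | mem a ha =>
      obtain ⟨x, rfl⟩ := ha
      rw [star_universalRep]
      exact Submodule.smul_mem _ _ (Submodule.subset_span ⟨_, rfl⟩)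
    | zero => rw [star_zero]; exact Submodule.zero_mem _
    | add a b _ _ ha hb => rw [star_add]; exact Submodule.add_mem _ ha hb
    | smul c a _ ha => rw [star_smul]; exact Submodule.smul_mem _ _ ha

theorem gen_zero : gen Θ 0 = 1 := Subtype.ext universalRep_zero

theorem gen_mul_star (x : Fin d → ℤ) : gen Θ x * star (gen Θ x) = 1 :=
  Subtype.ext (universalRep_mul_star x)

theorem norm_gen_le (x : Fin d → ℤ) : ‖gen Θ x‖ ≤ 1 := norm_universalRep_le x

theorem exists_finsupp_norm_sub_lt (a : Torus Θ) {ε : ℝ} (hε : 0 < ε) :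
    ∃ β : (Fin d → ℤ) →₀ ℂ, ‖a - β.sum fun x c => c • gen Θ x‖ < ε := by
  have ha : (a : BoundedFamilies Θ) ∈
      closure (StarAlgebra.adjoin ℂ (Set.range (universalRep Θ)) : Set (BoundedFamilies Θ)) := a.2
  obtain ⟨b, hb, hab⟩ := Metric.mem_closure_iff.1 ha ε hε
  obtain ⟨β, rfl⟩ := Finsupp.mem_span_range_iff_exists_finsupp.1 (mem_span_of_mem_adjoin hb)
  refine ⟨β, ?_⟩
  rw [dist_eq_norm] at hab
  have : (((β.sum fun x c => c • gen Θ x) : Torus Θ) : BoundedFamilies Θ) =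
      β.sum fun x c => c • universalRep Θ x := by
    simp only [Finsupp.sum, AddSubmonoidClass.coe_finsetSum]
    rfl
  rw [← this] at hab
  exact hab

/-- The commutator `ω_Θ(y, x) ω_Θ(x, y)⁻¹` of the cocycle. -/
noncomputable def commPairing (Θ : Matrix (Fin d) (Fin d) ℝ) (y x : Fin d → ℤ) : Circle :=
  omega Θ y x * (omega Θ x y)⁻¹

theorem universalRep_conj (y x : Fin d → ℤ) :
    universalRep Θ y * universalRep Θ x * star (universalRep Θ y) =
      (commPairing Θ y x : ℂ) • universalRep Θ x := by
  have h1 : universalRep Θ (x + y) =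
      ((omega Θ x y : ℂ)⁻¹) • (universalRep Θ x * universalRep Θ y) := by
    rw [universalRep_mul, smul_smul, inv_mul_cancel₀ (Circle.coe_ne_zero _), one_smul]
  rw [universalRep_mul, add_comm y x, h1, smul_smul, smul_mul_assoc, mul_assoc,
    universalRep_mul_star, mul_one, commPairing, Circle.coe_mul, Circle.coe_inv]

theorem gen_conj (y x : Fin d → ℤ) :
    gen Θ y * gen Θ x * star (gen Θ y) = (commPairing Θ y x : ℂ) • gen Θ x :=
  Subtype.ext (universalRep_conj y x)

end Generators

/-! ### The twisted regular representation -/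

section RegularRep

variable {d : ℕ} {Θ : Matrix (Fin d) (Fin d) ℝ}

/-- Translation by `x` twisted by the cocycle, on `ℓ²(ℤ^d)`. -/
noncomputable def regularShift (Θ : Matrix (Fin d) (Fin d) ℝ) (x : Fin d → ℤ)
    (f : lp (fun _ : Fin d → ℤ => ℂ) 2) : lp (fun _ : Fin d → ℤ => ℂ) 2 :=
  ⟨fun z => (omega Θ x z : ℂ) * f (z - x), by
    have hf := (memℓp_gen_iff (p := 2) (by norm_num)).1 (lp.memℓp f)
    refine (memℓp_gen_iff (p := 2) (by norm_num)).2 ?_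
    simp only [norm_mul, Circle.norm_coe, one_mul]
    exact (Equiv.subRight x).summable_iff.2 hf⟩

theorem regularShift_apply (x z : Fin d → ℤ) (f : lp (fun _ : Fin d → ℤ => ℂ) 2) :
    regularShift Θ x f z = (omega Θ x z : ℂ) * f (z - x) := rfl

theorem norm_regularShift (x : Fin d → ℤ) (f : lp (fun _ : Fin d → ℤ => ℂ) 2) :
    ‖regularShift Θ x f‖ = ‖f‖ := by
  have h2 : 0 < (2 : ℝ≥0∞).toReal := by norm_num
  rw [lp.norm_eq_tsum_rpow h2, lp.norm_eq_tsum_rpow h2]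
  congr 1
  simp only [regularShift_apply, norm_mul, Circle.norm_coe, one_mul]
  exact (Equiv.subRight x).tsum_eq fun z => ‖f z‖ ^ (2 : ℝ≥0∞).toReal

theorem regularShift_regularShift (hΘ : Θᵀ = -Θ) (x y : Fin d → ℤ)
    (f : lp (fun _ : Fin d → ℤ => ℂ) 2) :
    regularShift Θ x (regularShift Θ y f) = (omega Θ x y : ℂ) • regularShift Θ (x + y) f := by
  refine lp.ext (funext fun z => ?_)
  rw [lp.coeFn_smul, Pi.smul_apply]
  simp only [regularShift_apply, smul_eq_mul]
  -- Expanding `omega Θ y (z - x)` leaves the factor `(omega Θ y x)⁻¹`, which is `omega Θ x y` by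
  -- skew symmetry.
  rw [sub_sub, sub_eq_add_neg z x, omega_add_right, omega_neg_right, ← omega_swap hΘ,
    omega_add_left]
  push_cast
  ring

/-- The twisted translations as isometric automorphisms of `ℓ²(ℤ^d)`. -/
noncomputable def regularIsometryEquiv (hΘ : Θᵀ = -Θ) (x : Fin d → ℤ) :
    lp (fun _ : Fin d → ℤ => ℂ) 2 ≃ₗᵢ[ℂ] lp (fun _ : Fin d → ℤ => ℂ) 2 :=
  LinearIsometryEquiv.ofSurjective
    { toFun := regularShift Θ x
      map_add' := fun f g => lp.ext (funext fun z => mul_add _ _ _)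
      map_smul' := fun c f => lp.ext (funext fun z => mul_left_comm _ _ _)
      norm_map' := norm_regularShift x }
    fun f => ⟨((omega Θ x (-x) : ℂ))⁻¹ • regularShift Θ (-x) f, by
      have h := regularShift_regularShift hΘ x (-x) f
      have h0 : regularShift Θ 0 f = f := lp.ext (funext fun z => by
        rw [regularShift_apply, omega_zero_left, sub_zero, Circle.coe_one, one_mul])
      rw [add_neg_cancel, h0] at h
      rw [map_smul]
      refine Eq.trans (congrArg (_ • ·) h) ?_
      rw [smul_smul, inv_mul_cancel₀ (Circle.coe_ne_zero _), one_smul]⟩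

/-- The left regular twisted representation. -/
noncomputable def regularRep (hΘ : Θᵀ = -Θ) : TwistedRep Θ where
  H := lp (fun _ : Fin d → ℤ => ℂ) 2
  nontrivial := ⟨lp.single 2 0 1, 0, fun h => by
    have := congrArg (fun f : lp (fun _ : Fin d → ℤ => ℂ) 2 => f 0) h
    simp at this⟩
  v x := Unitary.linearIsometryEquiv.symm (regularIsometryEquiv hΘ x)
  map_mul x y := ContinuousLinearMap.ext fun f => regularShift_regularShift hΘ x y f

/-- An empty family of representations would give the zero ring; the regular representation supplies
a factor in which `0 ≠ 1`. -/
theorem nontrivial_torus (hΘ : Θᵀ = -Θ) : Nontrivial (Torus Θ) := by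
  refine ⟨0, 1, fun h => ?_⟩
  have h1 : (0 : BoundedFamilies Θ) = 1 := congrArg Subtype.val h
  have h2 : (0 : (regularRep hΘ).H →L[ℂ] (regularRep hΘ).H) = 1 :=
    congrArg (fun T : BoundedFamilies Θ =>
      (T : ∀ ρ : TwistedRep Θ, ρ.H →L[ℂ] ρ.H) (regularRep hΘ)) h1
  exact zero_ne_one h2

end RegularRep

/-! ### Fourier analysis of the dual torus action -/

section DualAction

open MeasureTheory UnitAddTorus

/-- The circle carries its normalized Haar measure. -/
noncomputable local instance : MeasureSpace UnitAddCircle := ⟨AddCircle.haarAddCircle⟩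

local instance : Measure.IsAddHaarMeasure (volume : Measure UnitAddCircle) :=
  inferInstanceAs (Measure.IsAddHaarMeasure AddCircle.haarAddCircle)

local instance : IsProbabilityMeasure (volume : Measure UnitAddCircle) :=
  inferInstanceAs (IsProbabilityMeasure AddCircle.haarAddCircle)

variable {d : ℕ} {Θ : Matrix (Fin d) (Fin d) ℝ}

theorem norm_mFourier_apply (x : Fin d → ℤ) (z : UnitAddTorus (Fin d)) :
    ‖mFourier x z‖ = 1 := by
  simp only [mFourier, ContinuousMap.coe_mk, norm_prod, fourier_apply, Circle.norm_coe,
    Finset.prod_const_one]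

theorem integral_mFourier (x : Fin d → ℤ) :
    ∫ z : UnitAddTorus (Fin d), mFourier x z = if x = 0 then 1 else 0 := by
  have h := (orthonormal_iff_ite.1 (orthonormal_mFourier (d := Fin d))) 0 x
  rw [ContinuousMap.inner_toLp] at h
  simp only [mFourier_zero] at h
  simpa [eq_comm] using h

theorem eq_zero_of_mFourierCoeff_eq_zero {g : UnitAddTorus (Fin d) → ℂ} (hg : Continuous g)
    (h : ∀ x, mFourierCoeff g x = 0) (z : UnitAddTorus (Fin d)) : g z = 0 := by
  have h1 : mFourierCoeff (⟨g, hg⟩ : C(UnitAddTorus (Fin d), ℂ)) = 0 := funext h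
  have h2 := hasSum_mFourier_series_apply_of_summable (f := ⟨g, hg⟩)
    (by rw [h1]; exact summable_zero) z
  simp only [h1, Pi.zero_apply, zero_smul] at h2
  exact h2.unique hasSum_zero

/-- The twisted representation `x ↦ z^x ρ(x)`, for `z` in the torus. -/
noncomputable abbrev TwistedRep.twist (ρ : TwistedRep Θ) (z : UnitAddTorus (Fin d)) :
    TwistedRep Θ where
  H := ρ.H
  v x := ⟨mFourier x z • (ρ.v x : ρ.H →L[ℂ] ρ.H), by
    have h : star (mFourier x z) * mFourier x z = 1 := by
      have := Complex.conj_mul' (mFourier x z)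
      rw [norm_mFourier_apply] at this
      simpa using this
    rw [Unitary.mem_iff, star_smul, smul_mul_smul_comm, smul_mul_smul_comm, mul_comm (mFourier x z),
      h, one_smul, one_smul]
    exact (ρ.v x).2⟩
  map_mul x y := by
    simp only [smul_mul_smul_comm, ρ.map_mul, mFourier_add, smul_smul, mul_comm]

/-- The matrix coefficient `z ↦ ⟨ξ, γ_z(a)_ρ η⟩` of the dual action `γ` of the torus. -/
noncomputable def dualCoeff (ρ : TwistedRep Θ) (ξ η : ρ.H) (a : BoundedFamilies Θ)
    (z : UnitAddTorus (Fin d)) : ℂ :=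
  inner ℂ ξ ((show ρ.H →L[ℂ] ρ.H from
    (a : ∀ ρ : TwistedRep Θ, ρ.H →L[ℂ] ρ.H) (ρ.twist z)) η)

variable (ρ : TwistedRep Θ) (ξ η : ρ.H)

theorem dualCoeff_sub (a b : BoundedFamilies Θ) (z : UnitAddTorus (Fin d)) :
    dualCoeff ρ ξ η (a - b) z = dualCoeff ρ ξ η a z - dualCoeff ρ ξ η b z :=
  inner_sub_right _ _ _

theorem dualCoeff_add (a b : BoundedFamilies Θ) (z : UnitAddTorus (Fin d)) :
    dualCoeff ρ ξ η (a + b) z = dualCoeff ρ ξ η a z + dualCoeff ρ ξ η b z :=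
  inner_add_right _ _ _

theorem dualCoeff_zero (z : UnitAddTorus (Fin d)) : dualCoeff ρ ξ η 0 z = 0 :=
  inner_zero_right _

theorem dualCoeff_smul (c : ℂ) (a : BoundedFamilies Θ) (z : UnitAddTorus (Fin d)) :
    dualCoeff ρ ξ η (c • a) z = c * dualCoeff ρ ξ η a z :=
  inner_smul_right _ _ _

theorem dualCoeff_universalRep (x : Fin d → ℤ) (z : UnitAddTorus (Fin d)) :
    dualCoeff ρ ξ η (universalRep Θ x) z =
      mFourier x z * inner ℂ ξ ((ρ.v x : ρ.H →L[ℂ] ρ.H) η) :=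
  inner_smul_right _ _ _

theorem dualCoeff_mul_universalRep (a : BoundedFamilies Θ) (x : Fin d → ℤ)
    (z : UnitAddTorus (Fin d)) :
    dualCoeff ρ ξ η (a * universalRep Θ x) z =
      mFourier x z * dualCoeff ρ ξ ((ρ.v x : ρ.H →L[ℂ] ρ.H) η) a z := by
  rw [dualCoeff, dualCoeff, ← inner_smul_right, ← map_smul]
  rfl

theorem norm_dualCoeff_le (a : BoundedFamilies Θ) (z : UnitAddTorus (Fin d)) :
    ‖dualCoeff ρ ξ η a z‖ ≤ ‖a‖ * (‖ξ‖ * ‖η‖) := by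
  refine (norm_inner_le_norm _ _).trans ?_
  have h1 := (show ρ.H →L[ℂ] ρ.H from
    (a : ∀ ρ : TwistedRep Θ, ρ.H →L[ℂ] ρ.H) (ρ.twist z)).le_opNorm η
  have h2 := lp.norm_apply_le_norm ENNReal.top_ne_zero a (ρ.twist z)
  calc _ ≤ ‖ξ‖ * (‖a‖ * ‖η‖) := by
        gcongr
        exact h1.trans (mul_le_mul_of_nonneg_right h2 (norm_nonneg _))
    _ = _ := by ring

/-- Elements of the span give trigonometric polynomials in `z`, and `norm_dualCoeff_le` is uniform
in `z`, so norm limits give uniform limits. -/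
theorem continuous_dualCoeff_of_mem {a : BoundedFamilies Θ} (ha : a ∈ Torus Θ) :
    Continuous (dualCoeff ρ ξ η a) := by
  have hspan : ∀ b ∈ Submodule.span ℂ (Set.range (universalRep Θ)),
      Continuous (dualCoeff ρ ξ η b) := by
    intro b hb
    induction hb using Submodule.span_induction with
    | mem b hb =>
      obtain ⟨x, rfl⟩ := hb
      simp only [funext (dualCoeff_universalRep ρ ξ η x)]
      fun_prop
    | zero => simp only [funext (dualCoeff_zero ρ ξ η)]; exact continuous_const
    | add b c _ _ hb hc => simp only [funext (dualCoeff_add ρ ξ η b c)]; exact hb.add hc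
    | smul t b _ hb => simp only [funext (dualCoeff_smul ρ ξ η t b)]; exact hb.const_mul t
  refine continuous_of_uniform_approx_of_continuous fun u hu => ?_
  obtain ⟨ε, hε, hεu⟩ := Metric.mem_uniformity_dist.1 hu
  have hC : 0 < ‖ξ‖ * ‖η‖ + 1 := by positivity
  obtain ⟨b, hb, hab⟩ := Metric.mem_closure_iff.1 ha (ε / (‖ξ‖ * ‖η‖ + 1)) (by positivity)
  refine ⟨dualCoeff ρ ξ η b, hspan b (mem_span_of_mem_adjoin hb), fun z => hεu ?_⟩
  rw [dist_eq_norm, ← dualCoeff_sub]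
  rw [dist_eq_norm] at hab
  calc ‖dualCoeff ρ ξ η (a - b) z‖ ≤ ‖a - b‖ * (‖ξ‖ * ‖η‖) := norm_dualCoeff_le ρ ξ η _ z
    _ ≤ ‖a - b‖ * (‖ξ‖ * ‖η‖ + 1) := by gcongr; linarith
    _ < ε / (‖ξ‖ * ‖η‖ + 1) * (‖ξ‖ * ‖η‖ + 1) := by gcongr
    _ = ε := div_mul_cancel₀ _ hC.ne'

theorem continuous_dualCoeff (a : Torus Θ) : Continuous (dualCoeff ρ ξ η (a : BoundedFamilies Θ)) :=
  continuous_dualCoeff_of_mem ρ ξ η a.2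

/-- The mean of a matrix coefficient of the dual action over the torus. -/
noncomputable def dualMean (a : Torus Θ) : ℂ := ∫ z, dualCoeff ρ ξ η (a : BoundedFamilies Θ) z

theorem norm_dualMean_sub_le (a b : Torus Θ) :
    ‖dualMean ρ ξ η a - dualMean ρ ξ η b‖ ≤ ‖a - b‖ * (‖ξ‖ * ‖η‖) := by
  have hint : ∀ a : Torus Θ, Integrable (dualCoeff ρ ξ η (a : BoundedFamilies Θ)) := fun a =>
    (continuous_dualCoeff ρ ξ η a).integrable_of_hasCompactSupport
      (HasCompactSupport.of_compactSpace _)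
  rw [dualMean, dualMean, ← integral_sub (hint a) (hint b)]
  refine (norm_integral_le_of_norm_le_const (C := ‖a - b‖ * (‖ξ‖ * ‖η‖))
    (Filter.Eventually.of_forall fun z => ?_)).trans ?_
  · rw [← dualCoeff_sub]
    exact norm_dualCoeff_le ρ ξ η _ z
  · simp

/-- Only the trivial character has nonzero integral, so the mean reads off the constant coefficient.
-/
theorem dualMean_finsupp (β : (Fin d → ℤ) →₀ ℂ) :
    dualMean ρ ξ η (β.sum fun x c => c • gen Θ x) = β 0 * inner ℂ ξ η := by
  have h1 : ∀ z, dualCoeff ρ ξ η ((β.sum fun x c => c • gen Θ x : Torus Θ) :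
      BoundedFamilies Θ) z = ∑ x ∈ β.support,
        β x * (mFourier x z * inner ℂ ξ ((ρ.v x : ρ.H →L[ℂ] ρ.H) η)) := by
    intro z
    have h2 : ((β.sum fun x c => c • gen Θ x : Torus Θ) : BoundedFamilies Θ) =
        ∑ x ∈ β.support, β x • universalRep Θ x := by
      simp only [Finsupp.sum, AddSubmonoidClass.coe_finsetSum]
      rfl
    rw [h2]
    induction β.support using Finset.induction_on with
    | empty => simp [dualCoeff_zero]
    | insert x s hx ih =>
      rw [Finset.sum_insert hx, Finset.sum_insert hx, dualCoeff_add, ih, dualCoeff_smul,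
        dualCoeff_universalRep]
  have hv : (ρ.v 0 : ρ.H →L[ℂ] ρ.H) = 1 :=
    congrArg (fun T : BoundedFamilies Θ => (T : ∀ ρ : TwistedRep Θ, ρ.H →L[ℂ] ρ.H) ρ)
      universalRep_zero
  simp only [dualMean, h1]
  rw [integral_finsetSum]
  · simp only [integral_const_mul, integral_mul_const, integral_mFourier]
    rw [Finset.sum_eq_single 0]
    · simp [hv]
    · intro x _ hx
      simp [hx]
    · intro h
      simp [Finsupp.notMem_support_iff.1 h]
  · intro x _
    exact Continuous.integrable_of_hasCompactSupport (by fun_prop)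
      (HasCompactSupport.of_compactSpace _)

/-- Right multiplication by `l(-x)` produces the character `z^(-x)` and the operator `ρ.v (-x)`; the
adjoint applied to `η` cancels the latter. -/
theorem mFourierCoeff_dualCoeff (a : Torus Θ) (x : Fin d → ℤ) :
    mFourierCoeff (dualCoeff ρ ξ η (a : BoundedFamilies Θ)) x =
      dualMean ρ ξ ((star (ρ.v (-x)) : ρ.H →L[ℂ] ρ.H) η) (a * gen Θ (-x)) := by
  refine integral_congr_ae (Filter.Eventually.of_forall fun z => ?_)
  have h : (ρ.v (-x) : ρ.H →L[ℂ] ρ.H) ((star (ρ.v (-x)) : ρ.H →L[ℂ] ρ.H) η) = η :=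
    DFunLike.congr_fun (Unitary.coe_mul_star_self (ρ.v (-x))) η
  have := dualCoeff_mul_universalRep ρ ξ ((star (ρ.v (-x)) : ρ.H →L[ℂ] ρ.H) η)
    (a : BoundedFamilies Θ) (-x) z
  rw [h] at this
  exact this.symm

theorem dualCoeff_apply_zero (a : BoundedFamilies Θ) :
    dualCoeff ρ ξ η a 0 = inner ℂ ξ ((a : ∀ ρ : TwistedRep Θ, ρ.H →L[ℂ] ρ.H) ρ η) := by
  have h : ρ.twist 0 = ρ := by
    have hv : ∀ x : Fin d → ℤ, mFourier x (0 : UnitAddTorus (Fin d)) = 1 := by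
      intro x
      simp [mFourier]
    unfold TwistedRep.twist
    simp only [hv, one_smul]
  -- `ρ.twist 0 = ρ` is only propositional, but both Hilbert spaces are definitionally `ρ.H`, so the
  -- heterogeneous equality becomes an equality of operators.
  have h2 : HEq ((a : ∀ ρ : TwistedRep Θ, ρ.H →L[ℂ] ρ.H) (ρ.twist 0))
      ((a : ∀ ρ : TwistedRep Θ, ρ.H →L[ℂ] ρ.H) ρ) := by rw [h]
  have h3 := eq_of_heq (α := ρ.H →L[ℂ] ρ.H) h2
  exact congrArg (fun T : ρ.H →L[ℂ] ρ.H => inner ℂ ξ (T η)) h3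

/-- Fourier uniqueness: an element of the noncommutative torus whose matrix coefficients under the
dual action all have mean zero, together with its translates by the generators, vanishes. -/
theorem eq_zero_of_dualMean_eq_zero {a : Torus Θ}
    (h : ∀ (x : Fin d → ℤ) (ρ : TwistedRep Θ) (ξ η : ρ.H),
      dualMean ρ ξ η (a * gen Θ x) = 0) : a = 0 := by
  refine Subtype.ext (lp.ext (funext fun ρ => ContinuousLinearMap.ext fun η => ?_))
  refine ext_inner_left ℂ (E := ρ.H) fun ξ => ?_
  refine (dualCoeff_apply_zero ρ ξ η a).symm.trans ?_
  rw [eq_zero_of_mFourierCoeff_eq_zero (continuous_dualCoeff ρ ξ η a)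
    fun x => (mFourierCoeff_dualCoeff ρ ξ η a x).trans (h (-x) ρ ξ _)]
  exact (inner_zero_right ξ).symm

end DualAction

/-! ### Averaging conjugations over powers of unitaries -/

section Averaging

variable {A : Type*} [NormedRing A] [NormedAlgebra ℂ A] {X : Type*}

/-- The bound is independent of `N`, so the average over `N` terms is `O(1/N)`. -/
theorem norm_sum_pow_le {χ : ℂ} (hχ : ‖χ‖ = 1) (h1 : χ ≠ 1) (N : ℕ) :
    ‖∑ k ∈ Finset.range N, χ ^ k‖ ≤ 2 / ‖χ - 1‖ := by
  rw [geom_sum_eq h1, norm_div]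
  gcongr
  calc ‖χ ^ N - 1‖ ≤ ‖χ ^ N‖ + ‖(1 : ℂ)‖ := norm_sub_le _ _
    _ = 2 := by rw [norm_pow, hχ]; norm_num

/-- The average of the conjugates of an element by the first `N` powers of `u`. -/
noncomputable def conjAverage (u w : A) (N : ℕ) : A →ₗ[ℂ] A :=
  (N : ℂ)⁻¹ • ∑ k ∈ Finset.range N, (LinearMap.mulLeft ℂ (u ^ k)) ∘ₗ (LinearMap.mulRight ℂ (w ^ k))

theorem conjAverage_apply (u w : A) (N : ℕ) (a : A) :
    conjAverage u w N a = (N : ℂ)⁻¹ • ∑ k ∈ Finset.range N, u ^ k * (a * w ^ k) := by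
  simp [conjAverage]

theorem pow_mul_mul_pow {u w a : A} {χ : ℂ} (h : u * a * w = χ • a) (k : ℕ) :
    u ^ k * (a * w ^ k) = χ ^ k • a := by
  induction k with
  | zero => simp
  | succ k ih =>
    calc u ^ (k + 1) * (a * w ^ (k + 1)) = u * (u ^ k * (a * w ^ k)) * w := by
          rw [pow_succ', pow_succ]; simp only [mul_assoc]
      _ = χ ^ k • (u * a * w) := by rw [ih, mul_smul_comm, smul_mul_assoc]
      _ = _ := by rw [h, smul_smul, pow_succ]

theorem conjAverage_eigen {u w a : A} {χ : ℂ} (h : u * a * w = χ • a) (N : ℕ) :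
    conjAverage u w N a = ((N : ℂ)⁻¹ * ∑ k ∈ Finset.range N, χ ^ k) • a := by
  rw [conjAverage_apply, Finset.sum_congr rfl fun k _ => pow_mul_mul_pow h k, ← Finset.sum_smul,
    smul_smul]

omit [NormedAlgebra ℂ A] in
theorem norm_pow_mul_mul_pow_le {u w : A} (hu : ‖u‖ ≤ 1) (hw : ‖w‖ ≤ 1) (a : A) (k : ℕ) :
    ‖u ^ k * (a * w ^ k)‖ ≤ ‖a‖ := by
  induction k with
  | zero => simp
  | succ k ih =>
    calc ‖u ^ (k + 1) * (a * w ^ (k + 1))‖ = ‖u * (u ^ k * (a * w ^ k)) * w‖ := by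
          rw [pow_succ', pow_succ]; simp only [mul_assoc]
      _ ≤ ‖u‖ * ‖u ^ k * (a * w ^ k)‖ * ‖w‖ := by
          refine (norm_mul_le _ _).trans ?_
          gcongr
          exact norm_mul_le _ _
      _ ≤ 1 * ‖a‖ * 1 := by gcongr
      _ = ‖a‖ := by ring

theorem norm_conjAverage_le {u w : A} (hu : ‖u‖ ≤ 1) (hw : ‖w‖ ≤ 1) (N : ℕ) (a : A) :
    ‖conjAverage u w N a‖ ≤ ‖a‖ := by
  rw [conjAverage_apply, norm_smul]
  have h : ‖∑ k ∈ Finset.range N, u ^ k * (a * w ^ k)‖ ≤ N * ‖a‖ := by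
    refine (norm_sum_le _ _).trans ?_
    refine (Finset.sum_le_sum fun k _ => norm_pow_mul_mul_pow_le hu hw a k).trans ?_
    simp
  rcases Nat.eq_zero_or_pos N with rfl | hN
  · simp
  · have : (0 : ℝ) < N := by exact_mod_cast hN
    calc ‖(N : ℂ)⁻¹‖ * ‖∑ k ∈ Finset.range N, u ^ k * (a * w ^ k)‖
        ≤ (N : ℝ)⁻¹ * (N * ‖a‖) := by
          rw [norm_inv, Complex.norm_natCast]; gcongr
      _ = ‖a‖ := by rw [← mul_assoc, inv_mul_cancel₀ this.ne', one_mul]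

theorem smul_mem_twoSidedIdeal {I : TwoSidedIdeal A} {a : A} (ha : a ∈ I) (c : ℂ) : c • a ∈ I := by
  rw [← one_mul a, ← smul_mul_assoc]
  exact I.mul_mem_left _ _ ha

theorem conjAverage_mem {I : TwoSidedIdeal A} (u w : A) (N : ℕ) {a : A} (ha : a ∈ I) :
    conjAverage u w N a ∈ I := by
  rw [conjAverage_apply]
  refine smul_mem_twoSidedIdeal ?_ _
  refine sum_mem fun k _ => ?_
  exact I.mul_mem_left _ _ (I.mul_mem_right _ _ ha)

/-- A contraction which preserves the two-sided ideals and fixes `1`, and for which the elements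
`g x` are eigenvectors with eigenvalues `c x` of modulus at most `1`. -/
structure IsAveraging (g : X → A) (M : A →ₗ[ℂ] A) (c : X → ℂ) : Prop where
  norm_le : ∀ a, ‖M a‖ ≤ ‖a‖
  mem : ∀ (I : TwoSidedIdeal A), ∀ a ∈ I, M a ∈ I
  map_one : M 1 = 1
  map_eigen : ∀ x, M (g x) = c x • g x
  norm_eigen_le : ∀ x, ‖c x‖ ≤ 1

theorem IsAveraging.comp {g : X → A} {M M' : A →ₗ[ℂ] A} {c c' : X → ℂ} (h : IsAveraging g M c)
    (h' : IsAveraging g M' c') : IsAveraging g (M ∘ₗ M') fun x => c x * c' x where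
  norm_le a := (h.norm_le _).trans (h'.norm_le a)
  mem I a ha := h.mem I _ (h'.mem I a ha)
  map_one := by rw [LinearMap.comp_apply, h'.map_one, h.map_one]
  map_eigen x := by
    rw [LinearMap.comp_apply, h'.map_eigen, map_smul, h.map_eigen, smul_smul, mul_comm]
  norm_eigen_le x := by
    rw [norm_mul]
    exact mul_le_one₀ (h.norm_eigen_le x) (norm_nonneg _) (h'.norm_eigen_le x)

theorem isAveraging_conjAverage {g : X → A} {u w : A} (hu : ‖u‖ ≤ 1) (hw : ‖w‖ ≤ 1)
    (huw : u * w = 1) {χ : X → ℂ} (hχ : ∀ x, ‖χ x‖ = 1) (h : ∀ x, u * g x * w = χ x • g x)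
    {N : ℕ} (hN : 0 < N) :
    IsAveraging g (conjAverage u w N) fun x => (N : ℂ)⁻¹ * ∑ k ∈ Finset.range N, χ x ^ k where
  norm_le := norm_conjAverage_le hu hw N
  mem I a ha := conjAverage_mem u w N ha
  map_one := by
    have hN' : (N : ℂ) ≠ 0 := by exact_mod_cast hN.ne'
    rw [conjAverage_eigen (χ := 1) (by rw [mul_one, huw, one_smul])]
    simp [hN']
  map_eigen x := conjAverage_eigen (h x) N
  norm_eigen_le x := by
    have hN' : (0 : ℝ) < N := by exact_mod_cast hN
    rw [norm_mul, norm_inv, Complex.norm_natCast, inv_mul_le_iff₀ hN', mul_one]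
    refine (norm_sum_le _ _).trans ?_
    simp [hχ]

/-- One average per element of `F`, composed. Eigenvalues multiply and have modulus at most `1`, so
a new factor does not spoil the smallness already achieved. -/
theorem exists_isAveraging {g : X → A} {ι : Type*} {u w : ι → A} (hu : ∀ i, ‖u i‖ ≤ 1)
    (hw : ∀ i, ‖w i‖ ≤ 1) (huw : ∀ i, u i * w i = 1) {χ : ι → X → ℂ} (hχ : ∀ i x, ‖χ i x‖ = 1)
    (h : ∀ i x, u i * g x * w i = χ i x • g x) (F : Finset X)
    (hF : ∀ x ∈ F, ∃ i, χ i x ≠ 1) {ε : ℝ} (hε : 0 < ε) :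
    ∃ (M : A →ₗ[ℂ] A) (c : X → ℂ), IsAveraging g M c ∧ ∀ x ∈ F, ‖c x‖ ≤ ε := by
  classical
  induction F using Finset.induction_on with
  | empty =>
    exact ⟨LinearMap.id, fun _ => 1, ⟨fun _ => le_rfl, fun _ _ h => h, rfl, fun x => by simp,
      fun x => by simp⟩, by simp⟩
  | insert y F _ ih =>
    obtain ⟨M, c, hM, hc⟩ := ih fun x hx => hF x (Finset.mem_insert_of_mem hx)
    obtain ⟨i, hi⟩ := hF y (Finset.mem_insert_self y F)
    obtain ⟨N, hN⟩ := exists_nat_gt (2 / ‖χ i y - 1‖ / ε)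
    have hN0 : (0 : ℝ) < N := lt_of_le_of_lt (by positivity) hN
    have hN1 : 0 < N := by exact_mod_cast hN0
    have hM' := isAveraging_conjAverage (g := g) (hu i) (hw i) (huw i) (hχ i) (h i) hN1
    refine ⟨_, _, hM'.comp hM, fun x hx => ?_⟩
    rw [norm_mul]
    rcases Finset.mem_insert.1 hx with rfl | hx
    · have h1 : ‖(N : ℂ)⁻¹ * ∑ k ∈ Finset.range N, χ i x ^ k‖ ≤ ε := by
        rw [norm_mul, norm_inv, Complex.norm_natCast, inv_mul_le_iff₀ hN0]
        refine (norm_sum_pow_le (hχ i x) hi N).trans ?_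
        exact ((div_lt_iff₀ hε).1 hN).le
      calc _ ≤ ε * 1 := mul_le_mul h1 (hM.norm_eigen_le x) (norm_nonneg _) hε.le
        _ = ε := mul_one ε
    · calc _ ≤ 1 * ε := mul_le_mul (hM'.norm_eigen_le x) (hc x hx) (norm_nonneg _) zero_le_one
        _ = ε := one_mul ε

/-- Otherwise `β⁻¹ • a` lies within distance less than `1` of `1`, hence is invertible by the
Neumann series, and `I` would be everything. -/
theorem norm_le_of_mem_twoSidedIdeal [CompleteSpace A] {I : TwoSidedIdeal A}
    (hI : I ≠ ⊤) {a : A} (ha : a ∈ I) (β : ℂ) : ‖β‖ ≤ ‖a - β • (1 : A)‖ := by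
  by_contra! hlt
  have hβ : β ≠ 0 := by
    rintro rfl
    rw [norm_zero] at hlt
    exact absurd hlt (norm_nonneg _).not_gt
  have h1 : ‖1 - β⁻¹ • a‖ < 1 := by
    have : 1 - β⁻¹ • a = -(β⁻¹ • (a - β • (1 : A))) := by
      rw [smul_sub, smul_smul, inv_mul_cancel₀ hβ, one_smul, neg_sub]
    rw [this, norm_neg, norm_smul, norm_inv, inv_mul_lt_iff₀ (norm_pos_iff.2 hβ), mul_one]
    exact hlt
  have h2 : IsUnit (β⁻¹ • a) := by
    have := (Units.oneSub _ h1).isUnit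
    simpa using this
  obtain ⟨v, hv⟩ := h2
  apply hI
  refine (TwoSidedIdeal.one_mem_iff I).1 ?_
  rw [← v.inv_mul, hv]
  exact I.mul_mem_left _ _ (smul_mem_twoSidedIdeal ha _)

theorem IsAveraging.norm_map_finsupp_sub_le [Zero X] {g : X → A} {M : A →ₗ[ℂ] A} {c : X → ℂ}
    (hM : IsAveraging g M c) (hg0 : g 0 = 1) (hg : ∀ x, ‖g x‖ ≤ 1) (β : X →₀ ℂ) {δ : ℝ}
    (hδ : 0 ≤ δ) (hc : ∀ x ∈ β.support, x ≠ 0 → ‖c x‖ ≤ δ) :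
    ‖M (β.sum fun x t => t • g x) - β 0 • (1 : A)‖ ≤ (∑ x ∈ β.support, ‖β x‖) * δ := by
  classical
  have h1 : M (β.sum fun x t => t • g x) = ∑ x ∈ β.support, β x • c x • g x := by
    rw [Finsupp.sum, map_sum]
    exact Finset.sum_congr rfl fun x _ => by rw [map_smul, hM.map_eigen]
  have hc0 : c 0 • (1 : A) = 1 := by
    rw [← hg0, ← hM.map_eigen, hg0, hM.map_one]
  have h2 : M (β.sum fun x t => t • g x) - β 0 • (1 : A) =
      ∑ x ∈ β.support.erase 0, β x • c x • g x := by
    rw [h1]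
    by_cases h0 : (0 : X) ∈ β.support
    · rw [← Finset.add_sum_erase _ _ h0, hg0, hc0, add_sub_cancel_left]
    · rw [Finset.erase_eq_of_notMem h0, Finsupp.notMem_support_iff.1 h0, zero_smul, sub_zero]
  rw [h2]
  calc ‖∑ x ∈ β.support.erase 0, β x • c x • g x‖
      ≤ ∑ x ∈ β.support.erase 0, ‖β x‖ * δ := by
        refine norm_sum_le_of_le _ fun x hx => ?_
        rw [norm_smul, norm_smul]
        refine mul_le_mul_of_nonneg_left ?_ (norm_nonneg _)
        calc ‖c x‖ * ‖g x‖ ≤ δ * 1 :=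
              mul_le_mul (hc x (Finset.mem_of_mem_erase hx) (Finset.ne_of_mem_erase hx)) (hg x)
                (norm_nonneg _) hδ
          _ = _ := mul_one _
    _ = (∑ x ∈ β.support.erase 0, ‖β x‖) * δ := by rw [Finset.sum_mul]
    _ ≤ (∑ x ∈ β.support, ‖β x‖) * δ := by
        refine mul_le_mul_of_nonneg_right ?_ hδ
        exact Finset.sum_le_sum_of_subset_of_nonneg (Finset.erase_subset _ _)
          fun x _ _ => norm_nonneg _

/-- An element of a proper ideal is approximated only by linear combinations of the `g x` with small
coefficient at `g 0 = 1`, provided conjugations separate `g 0` from the other `g x`. -/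
theorem norm_apply_zero_le_of_mem [CompleteSpace A] [Zero X] {g : X → A} {ι : Type*} {u w : ι → A}
    (hg0 : g 0 = 1) (hg : ∀ x, ‖g x‖ ≤ 1) (hu : ∀ i, ‖u i‖ ≤ 1)
    (hw : ∀ i, ‖w i‖ ≤ 1) (huw : ∀ i, u i * w i = 1) {χ : ι → X → ℂ} (hχ : ∀ i x, ‖χ i x‖ = 1)
    (h : ∀ i x, u i * g x * w i = χ i x • g x) (hnd : ∀ x, x ≠ 0 → ∃ i, χ i x ≠ 1)
    {I : TwoSidedIdeal A} (hI : I ≠ ⊤) {a : A} (ha : a ∈ I) {ε : ℝ} (hε : 0 < ε) (β : X →₀ ℂ)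
    (hβ : ‖a - β.sum fun x t => t • g x‖ < ε) : ‖β 0‖ ≤ 2 * ε := by
  classical
  set b : A := β.sum fun x t => t • g x with hb
  set K : ℝ := ∑ x ∈ β.support, ‖β x‖ with hK
  have hK0 : 0 ≤ K := Finset.sum_nonneg fun x _ => norm_nonneg _
  obtain ⟨M, c, hM, hc⟩ := exists_isAveraging hu hw huw hχ h (β.support.erase 0)
    (fun x hx => hnd x (Finset.ne_of_mem_erase hx)) (ε := ε / (K + 1)) (by positivity)
  have hMb : ‖M b - β 0 • (1 : A)‖ ≤ ε := by
    refine (hM.norm_map_finsupp_sub_le hg0 hg β (by positivity) fun x hx hx0 =>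
      hc x (Finset.mem_erase.2 ⟨hx0, hx⟩)).trans ?_
    rw [← hK, mul_div_assoc', div_le_iff₀ (by positivity)]
    nlinarith
  -- One `ε` comes from approximating `a` by `b`, the other from the surviving nonconstant terms of
  -- `M b`.
  have hMa : ‖M a - β 0 • (1 : A)‖ ≤ 2 * ε := by
    have h1 : M a - β 0 • (1 : A) = M (a - b) + (M b - β 0 • (1 : A)) := by
      rw [map_sub]; abel
    rw [h1]
    refine (norm_add_le _ _).trans ?_
    have := (hM.norm_le (a - b)).trans hβ.le
    linarith
  exact (norm_le_of_mem_twoSidedIdeal hI (hM.mem I a ha) (β 0)).trans hMa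

end Averaging

/-! ### Simplicity for a nondegenerate commutator pairing -/

section Simplicity

variable {d : ℕ} {Θ : Matrix (Fin d) (Fin d) ℝ}

theorem norm_star_gen_le (x : Fin d → ℤ) : ‖star (gen Θ x)‖ ≤ 1 :=
  (norm_star (universalRep Θ x)).le.trans (norm_universalRep_le x)

/-- The mean of `a` is within `O(ε)` of `β 0 * inner ℂ ξ η` for any finite `ε`-approximation `β`,
and `β 0` is itself `O(ε)` because the ideal is proper. -/
theorem dualMean_eq_zero_of_mem
    (hnd : ∀ x : Fin d → ℤ, x ≠ 0 → ∃ y, commPairing Θ y x ≠ 1)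
    {I : TwoSidedIdeal (Torus Θ)} (hI : I ≠ ⊤) {a : Torus Θ} (ha : a ∈ I)
    (ρ : TwistedRep Θ) (ξ η : ρ.H) : dualMean ρ ξ η a = 0 := by
  have key : ∀ ε : ℝ, 0 < ε → ‖dualMean ρ ξ η a‖ ≤ 3 * (‖ξ‖ * ‖η‖) * ε := by
    intro ε hε
    obtain ⟨β, hβ⟩ := exists_finsupp_norm_sub_lt a hε
    have hβ0 : ‖β 0‖ ≤ 2 * ε := norm_apply_zero_le_of_mem (A := Torus Θ) (g := gen Θ) (u := gen Θ)
      (w := fun y => star (gen Θ y)) gen_zero norm_gen_le norm_gen_le norm_star_gen_le gen_mul_star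
      (χ := fun y x => (commPairing Θ y x : ℂ)) (fun y x => Circle.norm_coe _) gen_conj
      (fun x hx => (hnd x hx).imp fun y hy h => hy (Circle.ext h)) hI ha hε β hβ
    have h3 := norm_dualMean_sub_le ρ ξ η a (β.sum fun x c => c • gen Θ x)
    rw [dualMean_finsupp] at h3
    have h4 : ‖β 0 * inner ℂ ξ η‖ ≤ 2 * ε * (‖ξ‖ * ‖η‖) := by
      rw [norm_mul]
      exact mul_le_mul hβ0 (norm_inner_le_norm _ _) (norm_nonneg _) (by positivity)
    have h5 := h3.trans (mul_le_mul_of_nonneg_right hβ.le (by positivity))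
    have h6 := norm_le_norm_add_norm_sub' (dualMean ρ ξ η a) (β 0 * inner ℂ ξ η)
    linarith
  have h0 : ‖dualMean ρ ξ η a‖ ≤ 0 := by
    set K : ℝ := 3 * (‖ξ‖ * ‖η‖) with hK
    have hK0 : 0 ≤ K := by positivity
    refine le_of_forall_pos_le_add fun ε hε => ?_
    refine (key (ε / (K + 1)) (by positivity)).trans ?_
    rw [zero_add, mul_div_assoc', div_le_iff₀ (by positivity)]
    nlinarith
  exact norm_le_zero_iff.1 h0

/-- The noncommutative torus of a nondegenerate skew symmetric matrix is simple. -/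
theorem isSimpleAlgebra_torus (hΘ : Θᵀ = -Θ)
    (hnd : ∀ x : Fin d → ℤ, x ≠ 0 → ∃ y, commPairing Θ y x ≠ 1) : IsSimpleAlgebra (Torus Θ) := by
  refine ⟨nontrivial_torus hΘ, fun I _ => or_iff_not_imp_right.2 fun hI => ?_⟩
  refine (TwoSidedIdeal.ext fun a => ?_)
  rw [TwoSidedIdeal.mem_bot]
  refine ⟨fun ha => ?_, fun ha => ha ▸ I.zero_mem⟩
  -- The ideal also contains every `a * gen Θ x`, so all Fourier coefficients vanish, not just the
  -- constant one.
  exact eq_zero_of_dualMean_eq_zero fun x ρ ξ η =>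
    dualMean_eq_zero_of_mem hnd hI (I.mul_mem_right _ _ ha) ρ ξ η

end Simplicity

/-! ### Nondegeneracy of the prime form -/

section Nondegeneracy

open Finset Matrix

/-- By skew symmetry the pairing is `exp(2πi ⟨Θ y, x⟩)`. -/
theorem exists_int_of_commPairing_eq_one {d : ℕ} {Θ : Matrix (Fin d) (Fin d) ℝ} (hΘ : Θᵀ = -Θ)
    {x y : Fin d → ℤ} (h : commPairing Θ y x = 1) :
    ∃ m : ℤ, ((Θ *ᵥ fun i => (y i : ℝ)) ⬝ᵥ fun i => (x i : ℝ)) = m := by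
  rw [commPairing, ← omega_swap hΘ] at h
  unfold omega at h
  rw [← Circle.exp_add, Circle.exp_eq_one] at h
  obtain ⟨m, hm⟩ := h
  refine ⟨m, mul_left_cancel₀ (mul_ne_zero two_ne_zero Real.pi_ne_zero) ?_⟩
  linarith

variable {p : ℕ}

/-- Extension by zero of a vector indexed by `Fin (p - 1)` to `ZMod p`. -/
def extendZMod (x : Fin (p - 1) → ℤ) (z : ZMod p) : ℤ :=
  if h : z.val < p - 1 then x ⟨z.val, h⟩ else 0

theorem extendZMod_natCast (x : Fin (p - 1) → ℤ) (i : Fin (p - 1)) :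
    extendZMod x ((i : ℕ) : ZMod p) = x i := by
  have hi := i.isLt
  have : ((i : ℕ) : ZMod p).val = i := ZMod.val_cast_of_lt (by omega)
  simp only [extendZMod, this]
  rw [dif_pos hi]

theorem extendZMod_neg_one (hp : 1 < p) (x : Fin (p - 1) → ℤ) : extendZMod x (-1) = 0 := by
  obtain ⟨n, rfl⟩ : ∃ n, p = n + 1 := ⟨p - 1, by omega⟩
  have : (-1 : ZMod (n + 1)).val = n := ZMod.val_neg_one n
  simp only [extendZMod, this]
  rw [dif_neg (by omega)]

/-- Since the extended vector vanishes at `-1`, the sum is a convolution over all of `ZMod p`, and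
the delta functions in `oddSymbol` pick out two values for each `θ k`. -/
theorem sum_primeForm_mul [NeZero p] (hp : 1 < p) (hodd : Odd p) (θ : ℕ → ℝ)
    (x : Fin (p - 1) → ℤ) (j : Fin (p - 1)) :
    ∑ i, primeForm p θ i j * (x i : ℝ) = ∑ k ∈ range ((p - 1) / 2),
      θ k * (extendZMod x ((j : ℕ) - ((k + 1 : ℕ) : ZMod p)) -
        extendZMod x ((j : ℕ) + ((k + 1 : ℕ) : ZMod p)) : ℤ) := by
  have h1 := sum_fin_pred_add (p := p) (by omega)
    fun z => oddSymbol p θ ((j : ℕ) - z) * (extendZMod x z : ℝ)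
  rw [extendZMod_neg_one hp, Int.cast_zero, mul_zero, add_zero] at h1
  have h2 : ∑ i, primeForm p θ i j * (x i : ℝ) =
      ∑ z : ZMod p, oddSymbol p θ ((j : ℕ) - z) * (extendZMod x z : ℝ) := by
    rw [← h1]
    refine Finset.sum_congr rfl fun i _ => ?_
    rw [primeForm_apply hodd, extendZMod_natCast]
  rw [h2]
  simp only [oddSymbol, Finset.sum_mul]
  rw [Finset.sum_comm]
  refine Finset.sum_congr rfl fun k _ => ?_
  simp only [mul_assoc, ← Finset.mul_sum, sub_mul, Finset.sum_sub_distrib, ite_mul, one_mul,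
    zero_mul]
  have e1 : ∀ z : ZMod p, ((j : ℕ) : ZMod p) - z = ((k + 1 : ℕ) : ZMod p) ↔
      z = (j : ℕ) - ((k + 1 : ℕ) : ZMod p) := fun z => by
    rw [sub_eq_iff_eq_add, eq_sub_iff_add_eq, add_comm, eq_comm]
  have e2 : ∀ z : ZMod p, ((j : ℕ) : ZMod p) - z = -((k + 1 : ℕ) : ZMod p) ↔
      z = (j : ℕ) + ((k + 1 : ℕ) : ZMod p) := fun z => by
    rw [sub_eq_iff_eq_add, eq_comm, neg_add_eq_iff_eq_add, add_comm]
  simp only [e1, e2, Finset.sum_ite_eq', Finset.mem_univ, if_true]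
  push_cast
  ring

theorem extendZMod_eq_of_linearIndependent [NeZero p] (hp : 1 < p) (hodd : Odd p) {θ : ℕ → ℝ}
    (hθ : LinearIndependent ℤ
      (Fin.cons 1 (fun i : Fin ((p - 1) / 2) => θ i) : Fin ((p - 1) / 2 + 1) → ℝ))
    (x : Fin (p - 1) → ℤ) (j : Fin (p - 1)) {m : ℤ}
    (h : ∑ i, primeForm p θ i j * (x i : ℝ) = m) {k : ℕ} (hk : k < (p - 1) / 2) :
    extendZMod x ((j : ℕ) - ((k + 1 : ℕ) : ZMod p)) =
      extendZMod x ((j : ℕ) + ((k + 1 : ℕ) : ZMod p)) := by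
  rw [sum_primeForm_mul hp hodd] at h
  set c : ℕ → ℤ := fun k => extendZMod x ((j : ℕ) - ((k + 1 : ℕ) : ZMod p)) -
    extendZMod x ((j : ℕ) + ((k + 1 : ℕ) : ZMod p)) with hc
  have h0 := Fintype.linearIndependent_iff.1 hθ
    -- The integer value `m` is moved across as the coefficient of `1` in a vanishing integral
    -- combination.
    (Fin.cons (-m) fun i : Fin ((p - 1) / 2) => c i) (by
      rw [Fin.sum_univ_succ]
      simp only [Fin.cons_zero, Fin.cons_succ, zsmul_eq_mul]
      rw [Fin.sum_univ_eq_sum_range (fun k => (c k : ℝ) * θ k) ((p - 1) / 2),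
        ← neg_eq_iff_add_eq_zero]
      rw [Finset.sum_congr rfl fun k _ => mul_comm (c k : ℝ) (θ k), h]
      simp) (Fin.succ ⟨k, hk⟩)
  rw [Fin.cons_succ] at h0
  exact sub_eq_zero.1 h0

/-- The hypothesis is symmetry under the reflections `z ↦ 2j - z`. Solving `2j = a - 1` in `ZMod p`
carries `a` to `-1`, where the extension is `0`; the parity of `a` decides which natural number
represents `j`. -/
theorem eq_zero_of_extendZMod_eq (h3 : 3 ≤ p) (hodd : Odd p) {x : Fin (p - 1) → ℤ}
    (h : ∀ (j : Fin (p - 1)) (k : ℕ), k < (p - 1) / 2 →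
      extendZMod x ((j : ℕ) - ((k + 1 : ℕ) : ZMod p)) =
        extendZMod x ((j : ℕ) + ((k + 1 : ℕ) : ZMod p))) : x = 0 := by
  obtain ⟨q, rfl⟩ := hodd
  ext ⟨a, ha⟩
  have hx := extendZMod_natCast x ⟨a, ha⟩
  have hneg := extendZMod_neg_one (by omega) x
  rw [← hx, Pi.zero_apply, ← hneg]
  rcases Nat.even_or_odd' a with ⟨b, rfl | rfl⟩
  -- For `a = 2b` the centre is `q + b` and the radius `q - b`; the other end is `2q = -1`.
  · have e := h ⟨q + b, by omega⟩ (q - 1 - b) (by omega)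
    have hsum : ((2 * q + 1 : ℕ) : ZMod (2 * q + 1)) = 0 := ZMod.natCast_self _
    have e1 : ((q + b : ℕ) : ZMod (2 * q + 1)) - ((q - 1 - b + 1 : ℕ) : ZMod _) =
        ((2 * b : ℕ) : ZMod (2 * q + 1)) := by
      rw [sub_eq_iff_eq_add, ← Nat.cast_add]
      congr 1
      omega
    have e2 : ((q + b : ℕ) : ZMod (2 * q + 1)) + ((q - 1 - b + 1 : ℕ) : ZMod _) =
        -1 := by
      rw [eq_neg_iff_add_eq_zero, ← Nat.cast_add, ← Nat.cast_succ, ← hsum]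
      congr 1
      omega
    rw [e1, e2] at e
    exact e
  · have e := h ⟨b, by omega⟩ b (by omega)
    have e1 : ((b : ℕ) : ZMod (2 * q + 1)) - ((b + 1 : ℕ) : ZMod _) = -1 := by
      push_cast; ring
    have e2 : ((b : ℕ) : ZMod (2 * q + 1)) + ((b + 1 : ℕ) : ZMod _) =
        ((2 * b + 1 : ℕ) : ZMod (2 * q + 1)) := by
      push_cast; ring
    rw [e1, e2] at e
    exact e.symm

theorem primeForm_nondegenerate (h3 : 3 ≤ p) (hodd : Odd p) {θ : ℕ → ℝ}
    (hθ : LinearIndependent ℤ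
      (Fin.cons 1 (fun i : Fin ((p - 1) / 2) => θ i) : Fin ((p - 1) / 2 + 1) → ℝ))
    {x : Fin (p - 1) → ℤ} (hx : x ≠ 0) : ∃ y, commPairing (primeForm p θ) y x ≠ 1 := by
  have : NeZero p := ⟨by omega⟩
  by_contra! hcon
  refine hx (eq_zero_of_extendZMod_eq h3 hodd fun j k hk => ?_)
  -- Testing against the basis vector `e_j` makes the `j`-th column of `Θ`, paired with `x`, an
  -- integer.
  obtain ⟨m, hm⟩ := exists_int_of_commPairing_eq_one (primeForm_transpose θ)
    (hcon (Pi.single j 1))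
  refine extendZMod_eq_of_linearIndependent (by omega) hodd hθ x j (m := m) ?_ hk
  rw [← hm]
  have hs : (fun i => ((Pi.single j 1 : Fin (p - 1) → ℤ) i : ℝ)) = Pi.single j 1 := by
    ext i
    by_cases hij : i = j
    · subst hij; simp
    · simp [hij]
  rw [hs, Matrix.mulVec_single_one]
  rfl

end Nondegeneracy

end NCTorus

theorem mainTheorem3 :
    (∀ (d n : ℕ) (f : Polynomial ℤ) (C : GL (Fin d) ℤ) (Θ : Matrix (Fin d) (Fin d) ℝ),
      3 ≤ d → f.Monic → f.natDegree = d →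
      (C : Matrix (Fin d) (Fin d) ℤ) = NCTorus.companionMatrix d f →
      0 < n → orderOf C = n →
      Θ.transpose = -Θ → Θ ≠ 0 →
      NCTorus.AdmitsCanonicalAction Θ (Subgroup.zpowers C) →
      ∃ θ : ℕ → ℝ, Θ = NCTorus.skewToeplitz d θ) ∧
    (∀ (p : ℕ) (hp : p.Prime), 3 ≤ p →
      ∀ Θ : Matrix (Fin (p - 1)) (Fin (p - 1)) ℝ, Θ.transpose = -Θ →
        (NCTorus.AdmitsCanonicalAction Θ (Subgroup.zpowers (NCTorus.cyclotomicCompanion p hp)) ↔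
          ∃ θ : ℕ → ℝ, Θ = NCTorus.primeForm p θ) ∧
        (∀ θ : ℕ → ℝ, Θ = NCTorus.primeForm p θ →
          LinearIndependent ℤ
            (Fin.cons 1 (fun i : Fin ((p - 1) / 2) => θ i) : Fin ((p - 1) / 2 + 1) → ℝ) →
          NCTorus.IsSimpleAlgebra (NCTorus.Torus Θ))) := by
  refine ⟨?_, ?_⟩
  · intro d n f C Θ _ _ _ hC _ _ hΘ _ hact
    rw [NCTorus.admitsCanonicalAction_zpowers_iff, hC] at hact
    exact ⟨_, NCTorus.eq_skewToeplitz_of_succ_succ hΘ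
      (NCTorus.apply_succ_succ_of_invariant f hact)⟩
  · intro p hp h3 Θ hΘ
    refine ⟨?_, ?_⟩
    · rw [NCTorus.admitsCanonicalAction_zpowers_iff]
      refine ⟨fun h => NCTorus.exists_eq_primeForm_of_invariant hp h3 hΘ h, ?_⟩
      rintro ⟨θ, rfl⟩
      exact NCTorus.primeForm_invariant hp h3 θ
    · rintro θ rfl hθ
      exact NCTorus.isSimpleAlgebra_torus hΘ fun x hx =>
        NCTorus.primeForm_nondegenerate h3 (hp.odd_of_ne_two (by omega)) hθ hx
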